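/- Let $\tau:[0,\infty)\to[0,\infty)$ be a normalized weight function, i.e. $\tau$ is continuous and nondecreasing, $\tau(t)=0$ for all $t\in[0,1]$, and $\lim_{t\to\infty}\tau(t)=\infty$. Assume that $\tau$ satisfies $(\omega_3)$: $\log t=o(\tau(t))$ as $t\to\infty$, and that its growth index $$\gamma(\tau):=\sup\Big\{\gamma>0:\ \exists K>1,\ \limsup_{t\to\infty}\frac{\tau(K^{\gamma}t)}{\tau(t)}<K\Big\}\in[0,\infty]$$ is positive. Let $0<\gamma<\gamma(\tau)$, and let $S_\gamma=\{z:|\arg z|<\gamma\pi/2\}$ be the unbounded sector of opening $\gamma\pi$ in the Riemann surface of the logarithm. For $x>0$ and $p\in\mathbb N=\{0,1,2,\dots\}$ put $$\varphi_\tau^*(y):=\sup_{s\in\mathbb R}\big(ys-\tau(e^s)\big)\ (y\ge0),\qquad T^x_p:=\exp\Big(\frac1x\varphi^*_\tau(xp)\Big),\qquad \widehat T^x_p:=p!\,T^x_p .$$ For a sequence $M=(M_p)_{p\in\mathbb N}$ of positive reals and $h>0$ let $\Lambda_{M,h}$ be the normed space of complex sequences $\lambda=(\lambda_p)_{p}$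 with $|\lambda|_{M,h}:=\sup_{p}\frac{|\lambda_p|}{h^pM_p}<\infty$, and let $\mathcal A_{M,h}(S_\gamma)$ be the normed space of holomorphic functions $f$ on $S_\gamma$ with $\|f\|_{M,h}:=\sup_{z\in S_\gamma,\,p}\frac{|f^{(p)}(z)|}{h^pM_p}<\infty$. Put $\mathcal A_{\{\widehat{\mathcal T}\}}(S_\gamma):=\bigcup_{x>0}\bigcup_{h>0}\mathcal A_{\widehat T^x,h}(S_\gamma)$ and $\Lambda_{\{\widehat{\mathcal T}\}}:=\bigcup_{x>0}\bigcup_{h>0}\Lambda_{\widehat T^x,h}$. The Borel map is $\mathcal B(f):=(f^{(p)}(0))_{p\in\mathbb N}$, where $f^{(p)}(0):=\lim_{z\to0,\,z\in S_\gamma}f^{(p)}(z)$. Then there exists a constant $k_0>0$ such that for all $x>0$ and $h>0$ there is a continuous linear map $$\Lambda_{\widehat T^x,h}\to\mathcal A_{\widehat T^{8x},k_0h}(S_\gamma),\qquad \lambda\mapsto f_\lambda,$$ with $\mathcal B(f_\lambda)=\lambda$ for every $\lambda\in\Lambda_{\widehat T^x,h}$ (in particular all the limits defining $\mathcal B(f_\lambda)$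 exist). Moreover, the Borel map $\mathcal B:\mathcal A_{\{\widehat{\mathcal T}\}}(S_\gamma)\to\Lambda_{\{\widehat{\mathcal T}\}}$ is well defined and surjective. -/

import Mathlib

open Filter Topology Asymptotics Set

noncomputable section

/-! ### Weight functions -/

/-- A weight function `ω : [0,∞) → [0,∞)`; only the values of `ω` on `[0,∞)` matter. -/
structure IsWeightFunction (ω : ℝ → ℝ) : Prop where
  nonneg : ∀ t, 0 ≤ t → 0 ≤ ω t
  continuousOn : ContinuousOn ω (Ici 0)
  monotoneOn : MonotoneOn ω (Ici 0)
  map_zero : ω 0 = 0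
  tendsto_atTop : Tendsto ω atTop atTop

/-- A normalized weight: a weight function that vanishes on `[0,1]`. -/
structure IsNormalizedWeight (ω : ℝ → ℝ) : Prop extends IsWeightFunction ω where
  normalized : ∀ t ∈ Icc (0 : ℝ) 1, ω t = 0

/-- Condition `(ω₃)`: `log t = o(ω(t))` as `t → ∞`. -/
def Omega3 (ω : ℝ → ℝ) : Prop := Real.log =o[atTop] ω

/-- The property `(P_{ω,γ})`: `limsup_{t → ∞} ω(K^γ t) / ω(t) < K` for some `K > 1`.
The limit superior is taken in the extended reals, so it is `+∞` for an unbounded quotient. -/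
def GrowthProperty (ω : ℝ → ℝ) (γ : ℝ) : Prop :=
  ∃ K : ℝ, 1 < K ∧
    limsup (fun t : ℝ => ((ω (K ^ γ * t) / ω t : ℝ) : EReal)) atTop < (K : EReal)

/-- The growth index `γ(ω) = sup {γ > 0 : (P_{ω,γ})}`, an element of `[0,∞]`. -/
def growthIndex (ω : ℝ → ℝ) : ENNReal :=
  ⨆ γ ∈ {γ : ℝ | 0 < γ ∧ GrowthProperty ω γ}, ENNReal.ofReal γ

/-- The Legendre-Fenchel-Young conjugate of `φ_ω(y) = ω(e^y)`. -/
def youngConj (ω : ℝ → ℝ) (x : ℝ) : ℝ := ⨆ y : ℝ, (x * y - ω (Real.exp y))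

/-- For a weight function with `(ω₃)` the supremum defining the conjugate is finite. -/
theorem bddAbove_youngConj {ω : ℝ → ℝ} (hω : IsWeightFunction ω) (h3 : Omega3 ω)
    {x : ℝ} (hx : 0 ≤ x) : BddAbove (range fun y : ℝ => x * y - ω (Real.exp y)) := by
  have h1 := (h3.bound (c := 1 / (x + 1)) (by positivity))
  have h2 := Real.tendsto_exp_atTop.eventually h1
  obtain ⟨Y, hY⟩ := (h2.and (eventually_ge_atTop 0)).exists_forall_of_atTop
  refine ⟨x * |Y|, ?_⟩
  rintro _ ⟨y, rfl⟩
  have hpos := hω.nonneg (Real.exp y) (Real.exp_pos y).le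
  rcases le_total Y y with h | h
  · obtain ⟨ha, hy⟩ := hY y h
    rw [Real.log_exp, Real.norm_of_nonneg hy, Real.norm_of_nonneg hpos, one_div,
      inv_mul_eq_div, le_div_iff₀ (by positivity)] at ha
    have : 0 ≤ x * |Y| := by positivity
    simp only
    nlinarith
  · have : x * y ≤ x * |Y| := mul_le_mul_of_nonneg_left (h.trans (le_abs_self Y)) hx
    simp only
    linarith

/-- The weight matrix `{T^x : x > 0}` of `τ`: `T^x_p = exp(φ_τ^*(x p) / x)`. -/
def weightMatrix (τ : ℝ → ℝ) (x : ℝ) (p : ℕ) : ℝ := Real.exp (1 / x * youngConj τ (x * p))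

/-- The weight matrix `{T̂^x : x > 0}`: `T̂^x_p = p! T^x_p`. -/
def weightMatrixHat (τ : ℝ → ℝ) (x : ℝ) (p : ℕ) : ℝ := (p.factorial : ℝ) * weightMatrix τ x p

/-! ### Weighted supremum norms -/

/-- The constants `C ≥ 0` with `|g i| ≤ C N_i` for all `i`. -/
def weightBounds {ι : Type} (N : ι → ℝ) (g : ι → ℂ) : Set ℝ :=
  {C | 0 ≤ C ∧ ∀ i, ‖g i‖ ≤ C * N i}

/-- The least `C ≥ 0` with `|g i| ≤ C N_i` for all `i`, that is `sup_i |g i| / N_i`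
(see `weightedNorm_eq_iSup`). -/
def weightedNorm {ι : Type} (N : ι → ℝ) (g : ι → ℂ) : ℝ := sInf (weightBounds N g)

section WeightedNorm

variable {ι : Type} {N : ι → ℝ} {f g : ι → ℂ}

theorem weightBounds_bddBelow : BddBelow (weightBounds N g) := ⟨0, fun _ h => h.1⟩

theorem weightedNorm_nonneg : 0 ≤ weightedNorm N g := Real.sInf_nonneg fun _ h => h.1

theorem weightBounds_add {C D : ℝ} (hC : C ∈ weightBounds N f) (hD : D ∈ weightBounds N g) :
    C + D ∈ weightBounds N (f + g) :=
  ⟨add_nonneg hC.1 hD.1, fun i => (norm_add_le _ _).trans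
    (by rw [add_mul]; exact add_le_add (hC.2 i) (hD.2 i))⟩

theorem weightBounds_smul (c : ℂ) {C : ℝ} (hC : C ∈ weightBounds N g) :
    ‖c‖ * C ∈ weightBounds N (c • g) :=
  ⟨mul_nonneg (norm_nonneg c) hC.1, fun i => by
    rw [Pi.smul_apply, norm_smul, mul_assoc]
    exact mul_le_mul_of_nonneg_left (hC.2 i) (norm_nonneg c)⟩

theorem weightedNorm_mem (hg : (weightBounds N g).Nonempty) :
    weightedNorm N g ∈ weightBounds N g := by
  refine IsClosed.csInf_mem ?_ hg weightBounds_bddBelow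
  have : weightBounds N g = Ici 0 ∩ ⋂ i, {C | ‖g i‖ ≤ C * N i} := by
    ext C; simp [weightBounds]
  rw [this]
  exact isClosed_Ici.inter
    (isClosed_iInter fun i => isClosed_le continuous_const (by fun_prop))

theorem weightedNorm_add_le (hf : (weightBounds N f).Nonempty) (hg : (weightBounds N g).Nonempty) :
    weightedNorm N (f + g) ≤ weightedNorm N f + weightedNorm N g :=
  csInf_le weightBounds_bddBelow (weightBounds_add (weightedNorm_mem hf) (weightedNorm_mem hg))

theorem weightedNorm_smul_le (c : ℂ) (hg : (weightBounds N g).Nonempty) :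
    weightedNorm N (c • g) ≤ ‖c‖ * weightedNorm N g :=
  csInf_le weightBounds_bddBelow (weightBounds_smul c (weightedNorm_mem hg))

theorem weightedNorm_smul (c : ℂ) (hg : (weightBounds N g).Nonempty) :
    weightedNorm N (c • g) = ‖c‖ * weightedNorm N g := by
  rcases eq_or_ne c 0 with rfl | hc
  · refine le_antisymm (weightedNorm_smul_le 0 hg) ?_
    rw [norm_zero, zero_mul]
    exact weightedNorm_nonneg
  · refine le_antisymm (weightedNorm_smul_le c hg) ?_
    have hcg : (weightBounds N (c • g)).Nonempty := ⟨_, weightBounds_smul c (weightedNorm_mem hg)⟩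
    have h := weightedNorm_smul_le c⁻¹ hcg
    rw [inv_smul_smul₀ hc, norm_inv, inv_mul_eq_div, le_div_iff₀ (norm_pos_iff.2 hc)] at h
    linarith

theorem eq_zero_of_weightedNorm_eq_zero (hg : (weightBounds N g).Nonempty)
    (h : weightedNorm N g = 0) : g = 0 := by
  have h1 := weightedNorm_mem hg
  rw [h] at h1
  funext i
  simpa using h1.2 i

/-- For positive weights the norm is the weighted supremum. -/
theorem weightedNorm_eq_iSup (hN : ∀ i, 0 < N i) (hg : (weightBounds N g).Nonempty) :
    weightedNorm N g = ⨆ i, ‖g i‖ / N i := by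
  have hm := weightedNorm_mem hg
  have hle : ∀ i, ‖g i‖ / N i ≤ weightedNorm N g := fun i => (div_le_iff₀ (hN i)).2 (hm.2 i)
  refine le_antisymm (csInf_le weightBounds_bddBelow ⟨?_, fun i => ?_⟩)
    (Real.iSup_le hle weightedNorm_nonneg)
  · exact Real.iSup_nonneg fun i => div_nonneg (norm_nonneg _) (hN i).le
  · rw [← div_le_iff₀ (hN i)]
    exact le_ciSup (f := fun i => ‖g i‖ / N i) ⟨_, by rintro _ ⟨i, rfl⟩; exact hle i⟩ i

end WeightedNorm

/-! ### The spaces of sequences -/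

/-- The sequences `a` with `sup_p |a_p| / (h^p M_p) < ∞`. -/
def seqSubmodule (M : ℕ → ℝ) (h : ℝ) : Submodule ℂ (ℕ → ℂ) where
  carrier := {a | (weightBounds (fun p => h ^ p * M p) a).Nonempty}
  add_mem' := by
    rintro a b ⟨C, hC⟩ ⟨D, hD⟩
    exact ⟨_, weightBounds_add hC hD⟩
  zero_mem' := ⟨0, le_rfl, fun i => by simp⟩
  smul_mem' := by
    rintro c a ⟨C, hC⟩
    exact ⟨_, weightBounds_smul c hC⟩

/-- The normed space `Λ_{M,h}`. -/
def SeqSpace (M : ℕ → ℝ) (h : ℝ) : Type := ↥(seqSubmodule M h)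

namespace SeqSpace

variable {M : ℕ → ℝ} {h : ℝ}

instance : AddCommGroup (SeqSpace M h) := inferInstanceAs (AddCommGroup ↥(seqSubmodule M h))
instance : Module ℂ (SeqSpace M h) := inferInstanceAs (Module ℂ ↥(seqSubmodule M h))

/-- The underlying sequence. -/
def toSeq (a : SeqSpace M h) : ℕ → ℂ := Subtype.val a

/-- The norm `|a|_{M,h} = sup_p |a_p| / (h^p M_p)`. -/
instance : Norm (SeqSpace M h) := ⟨fun a => weightedNorm (fun p => h ^ p * M p) a.toSeq⟩

theorem core : NormedSpace.Core ℂ (SeqSpace M h) where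
  norm_nonneg _ := weightedNorm_nonneg
  norm_smul c a := weightedNorm_smul c a.2
  norm_triangle a b := weightedNorm_add_le a.2 b.2
  norm_eq_zero_iff a := by
    constructor
    · intro h0
      exact Subtype.ext (eq_zero_of_weightedNorm_eq_zero a.2 h0)
    · rintro rfl
      have := weightedNorm_smul (N := fun p => h ^ p * M p) 0 (0 : SeqSpace M h).2
      rw [norm_zero, zero_mul, zero_smul] at this
      exact this

instance : NormedAddCommGroup (SeqSpace M h) := NormedAddCommGroup.ofCore core
instance : NormedSpace ℂ (SeqSpace M h) := NormedSpace.ofCore core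

end SeqSpace

/-! ### Sectors of the Riemann surface of the logarithm and holomorphic functions on them

The Riemann surface of the logarithm is the universal covering `exp : ℂ → ℂ \ {0}`. Its point `z`
is represented by the logarithm `ζ = log |z| + i arg z ∈ ℂ`, so that `arg z = Im ζ` may be any real
number and the projection of `z` to `ℂ \ {0}` is `exp ζ`; a function of `z` is written as a function
of `ζ`. -/

/-- The unbounded sector `S_γ = {z : |arg z| < γ π / 2}`, in the logarithmic coordinate. -/
def logSector (γ : ℝ) : Set ℂ := {ζ | |ζ.im| < γ * Real.pi / 2}

/-- The derivative `df/dz`, in the logarithmic coordinate: as `dz = exp(ζ) dζ`, it is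
`exp(-ζ) df/dζ`. -/
def surfDeriv (F : ℂ → ℂ) (ζ : ℂ) : ℂ := Complex.exp (-ζ) * deriv F ζ

/-- On functions that descend to the plane, `surfDeriv` is the usual complex derivative. -/
theorem surfDeriv_comp_exp (f : ℂ → ℂ) (ζ : ℂ) (hf : DifferentiableAt ℂ f (Complex.exp ζ)) :
    surfDeriv (fun η => f (Complex.exp η)) ζ = deriv f (Complex.exp ζ) := by
  have h : HasDerivAt (fun η => f (Complex.exp η)) (deriv f (Complex.exp ζ) * Complex.exp ζ) ζ :=
    hf.hasDerivAt.comp ζ (Complex.hasDerivAt_exp ζ)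
  rw [surfDeriv, h.deriv, mul_comm, mul_assoc, ← Complex.exp_add, add_neg_cancel,
    Complex.exp_zero, mul_one]

theorem isOpen_logSector (γ : ℝ) : IsOpen (logSector γ) :=
  isOpen_lt (by fun_prop) continuous_const

theorem differentiableOn_iterate_surfDeriv {γ : ℝ} {F : ℂ → ℂ}
    (hF : DifferentiableOn ℂ F (logSector γ)) (p : ℕ) :
    DifferentiableOn ℂ (surfDeriv^[p] F) (logSector γ) := by
  induction p with
  | zero => exact hF
  | succ p ih =>
    rw [Function.iterate_succ_apply']
    exact (Complex.differentiable_exp.comp differentiable_neg).differentiableOn.mul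
      (ih.deriv (isOpen_logSector γ))

theorem iterate_surfDeriv_add {γ : ℝ} {F G : ℂ → ℂ}
    (hF : DifferentiableOn ℂ F (logSector γ)) (hG : DifferentiableOn ℂ G (logSector γ)) (p : ℕ) :
    EqOn (surfDeriv^[p] (F + G)) (surfDeriv^[p] F + surfDeriv^[p] G) (logSector γ) := by
  induction p with
  | zero => exact fun _ _ => rfl
  | succ p ih =>
    intro ζ hζ
    have hn := (isOpen_logSector γ).mem_nhds hζ
    simp only [Function.iterate_succ_apply', Pi.add_apply, surfDeriv]
    rw [(ih.eventuallyEq_of_mem hn).deriv_eq,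
      deriv_add ((differentiableOn_iterate_surfDeriv hF p).differentiableAt hn)
        ((differentiableOn_iterate_surfDeriv hG p).differentiableAt hn), mul_add]

theorem iterate_surfDeriv_smul (c : ℂ) (F : ℂ → ℂ) (p : ℕ) :
    surfDeriv^[p] (c • F) = c • surfDeriv^[p] F := by
  induction p with
  | zero => rfl
  | succ p ih =>
    funext ζ
    rw [Function.iterate_succ_apply', ih, Function.iterate_succ_apply', Pi.smul_apply]
    simp only [surfDeriv, deriv_const_smul_field, smul_eq_mul]
    ring

/-! ### The spaces of ultraholomorphic functions -/

/-- The family `f^{(p)}(z)`, `p ∈ ℕ`, `z ∈ S_γ`. -/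
def derivFamily (γ : ℝ) (F : ℂ → ℂ) : ℕ × logSector γ → ℂ := fun i => surfDeriv^[i.1] F i.2

/-- The holomorphic functions `f` on `S_γ` with
`sup_{z ∈ S_γ, p ∈ ℕ} |f^{(p)}(z)| / (h^p M_p) < ∞`.
A function on the sector is represented by its extension by zero. -/
def ultraholoSubmodule (M : ℕ → ℝ) (h γ : ℝ) : Submodule ℂ (ℂ → ℂ) where
  carrier := {F | DifferentiableOn ℂ F (logSector γ) ∧ (∀ ζ ∉ logSector γ, F ζ = 0) ∧
    (weightBounds (fun i : ℕ × logSector γ => h ^ i.1 * M i.1) (derivFamily γ F)).Nonempty}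
  add_mem' := by
    rintro F G ⟨hF, hF0, C, hC⟩ ⟨hG, hG0, D, hD⟩
    refine ⟨hF.add hG, fun ζ hζ => by simp [hF0 ζ hζ, hG0 ζ hζ], C + D, ?_⟩
    have : derivFamily γ (F + G) = derivFamily γ F + derivFamily γ G :=
      funext fun i => iterate_surfDeriv_add hF hG i.1 i.2.2
    rw [this]
    exact weightBounds_add hC hD
  zero_mem' := by
    refine ⟨differentiableOn_const 0, fun _ _ => rfl, 0, le_rfl, fun i => ?_⟩
    have := congrFun (iterate_surfDeriv_smul 0 0 i.1) i.2
    simp only [zero_smul, Pi.zero_apply] at this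
    simp [derivFamily, this]
  smul_mem' := by
    rintro c F ⟨hF, hF0, C, hC⟩
    refine ⟨hF.const_smul c, fun ζ hζ => by simp [hF0 ζ hζ], ‖c‖ * C, ?_⟩
    have : derivFamily γ (c • F) = c • derivFamily γ F :=
      funext fun i => congrFun (iterate_surfDeriv_smul c F i.1) i.2
    rw [this]
    exact weightBounds_smul c hC

/-- The normed space `A_{M,h}(S_γ)`. -/
def UltraholoSpace (M : ℕ → ℝ) (h γ : ℝ) : Type := ↥(ultraholoSubmodule M h γ)

namespace UltraholoSpace

variable {M : ℕ → ℝ} {h γ : ℝ}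

instance : AddCommGroup (UltraholoSpace M h γ) :=
  inferInstanceAs (AddCommGroup ↥(ultraholoSubmodule M h γ))
instance : Module ℂ (UltraholoSpace M h γ) :=
  inferInstanceAs (Module ℂ ↥(ultraholoSubmodule M h γ))

/-- The underlying function, in the logarithmic coordinate. -/
def toFun (f : UltraholoSpace M h γ) : ℂ → ℂ := Subtype.val f

/-- The norm `‖f‖_{M,h} = sup_{z ∈ S_γ, p ∈ ℕ} |f^{(p)}(z)| / (h^p M_p)`. -/
instance : Norm (UltraholoSpace M h γ) :=
  ⟨fun f => weightedNorm (fun i : ℕ × logSector γ => h ^ i.1 * M i.1) (derivFamily γ f.toFun)⟩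

theorem derivFamily_add (f g : UltraholoSpace M h γ) :
    derivFamily γ (f + g).toFun = derivFamily γ f.toFun + derivFamily γ g.toFun :=
  funext fun i => iterate_surfDeriv_add f.2.1 g.2.1 i.1 i.2.2

theorem derivFamily_smul (c : ℂ) (f : UltraholoSpace M h γ) :
    derivFamily γ (c • f).toFun = c • derivFamily γ f.toFun :=
  funext fun i => congrFun (iterate_surfDeriv_smul c f.toFun i.1) i.2

theorem norm_smul_aux (c : ℂ) (f : UltraholoSpace M h γ) : ‖c • f‖ = ‖c‖ * ‖f‖ := by
  change weightedNorm _ (derivFamily γ (c • f).toFun) = _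
  rw [derivFamily_smul]
  exact weightedNorm_smul c f.2.2.2

theorem core : NormedSpace.Core ℂ (UltraholoSpace M h γ) where
  norm_nonneg _ := weightedNorm_nonneg
  norm_smul := norm_smul_aux
  norm_triangle f g := by
    change weightedNorm _ (derivFamily γ (f + g).toFun) ≤ _
    rw [derivFamily_add]
    exact weightedNorm_add_le f.2.2.2 g.2.2.2
  norm_eq_zero_iff f := by
    constructor
    · intro h0
      have h1 := eq_zero_of_weightedNorm_eq_zero f.2.2.2 h0
      refine Subtype.ext (funext fun ζ => ?_)
      by_cases hζ : ζ ∈ logSector γ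
      · exact congrFun h1 (0, ⟨ζ, hζ⟩)
      · exact f.2.2.1 ζ hζ
    · rintro rfl
      have := norm_smul_aux 0 (0 : UltraholoSpace M h γ)
      rwa [norm_zero, zero_mul, zero_smul] at this

instance : NormedAddCommGroup (UltraholoSpace M h γ) := NormedAddCommGroup.ofCore core
instance : NormedSpace ℂ (UltraholoSpace M h γ) := NormedSpace.ofCore core

end UltraholoSpace

/-! ### Roumieu classes of a weight matrix and the asymptotic Borel map -/

/-- `Λ_{{𝓜}} = ⋃_{x > 0} ⋃_{h > 0} Λ_{M^x,h}`. -/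
def roumieuSeq (𝓜 : ℝ → ℕ → ℝ) : Set (ℕ → ℂ) :=
  {a | ∃ x > 0, ∃ h > 0, a ∈ seqSubmodule (𝓜 x) h}

/-- `A_{{𝓜}}(S_γ) = ⋃_{x > 0} ⋃_{h > 0} A_{M^x,h}(S_γ)`. -/
def roumieuUltraholo (𝓜 : ℝ → ℕ → ℝ) (γ : ℝ) : Set (ℂ → ℂ) :=
  {F | ∃ x > 0, ∃ h > 0, F ∈ ultraholoSubmodule (𝓜 x) h γ}

/-- The filter of `z → 0`, `z ∈ S_γ`. -/
def nhdsVertex (γ : ℝ) : Filter ℂ :=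
  comap (fun ζ => ‖Complex.exp ζ‖) (𝓝 0) ⊓ 𝓟 (logSector γ)

/-- The graph of the Borel map on `S_γ`: `𝓑(f) = a`, that is, for every `p` the limit
`f^{(p)}(0) = lim_{z → 0, z ∈ S_γ} f^{(p)}(z)` exists and equals `a_p`. -/
def HasBorelImage (γ : ℝ) (F : ℂ → ℂ) (a : ℕ → ℂ) : Prop :=
  ∀ p, Tendsto (surfDeriv^[p] F) (nhdsVertex γ) (𝓝 (a p))

/-- The filter is proper, so a function has at most one Borel image. -/
theorem nhdsVertex_neBot {γ : ℝ} (hγ : 0 < γ) : (nhdsVertex γ).NeBot := by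
  have h : Tendsto (fun t : ℝ => (t : ℂ)) atBot (nhdsVertex γ) := by
    refine tendsto_inf.2 ⟨tendsto_comap_iff.2 ?_, tendsto_principal.2 (Eventually.of_forall ?_)⟩
    · simpa [Function.comp_def, Complex.norm_exp] using Real.tendsto_exp_atBot
    · intro t
      change |(t : ℂ).im| < _
      rw [Complex.ofReal_im, abs_zero]
      positivity
  exact h.neBot

theorem HasBorelImage.unique {γ : ℝ} (hγ : 0 < γ) {F : ℂ → ℂ} {a b : ℕ → ℂ}
    (ha : HasBorelImage γ F a) (hb : HasBorelImage γ F b) : a = b :=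
  haveI := nhdsVertex_neBot hγ
  funext fun p => tendsto_nhds_unique (ha p) (hb p)

end

/-! The extension is a truncated Laplace transform whose kernel is built from a holomorphic
substitute for the weight. In the coordinate ζ = log z a sector is a horizontal strip and dilations
are real translations. Since γ < γ(τ), some γ₁ > γ has the growth property, so φ(s) = τ(e^s)
satisfies φ(s+u) ≤ A e^{βu}(φ(s)+D) for u ≥ 0, with β < 1/γ₁. Convolving φ with a kernel that decays
like e^{-|s|/γ₁} and has nonnegative real part on a strip wider than that of S_γ gives a holomorphic
q with φ(Re ζ) ≤ 3 Re q(ζ) on that strip and q(s) ≤ φ(s+k) + C for real s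
(`exists_holomorphic_comparable`).

The kernel (u/z) exp(-q(log(u/z))/x) has moments m_n that dominate T^x_n up to a geometric factor
(`weightMatrix_le_laplaceMoment`), while the moments of a majorant of its modulus are at most a
constant times T^{8x}_n (`laplaceBound_le`). For λ in Λ_{T̂^x,h} the series ∑ λ_n u^n / (n! m_n)
therefore has a positive radius of convergence, and f_λ is the Laplace integral of its sum, cut off
at a small u. A monomial u^n is transformed exactly into m_n z^n on the whole sector
(`integral_pow_mul_laplaceKernel`), and the cut-off sum differs from its N-th partial sum by at most
a constant times (2b)^N u^N for every u > 0 (`norm_truncatedSeries_sub_le`). Hence f_λ differs from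
∑_{n<N} λ_n z^n / n! by a constant times H^N T^{8x}_N |z|^N, and Cauchy estimates on the narrower
sector S_γ turn this into bounds for all derivatives and into their boundary values
(`asymptotic_expansion`). The shift k depends on q only, which makes k₀ independent of x and h.

That the Borel map is well defined is separate: boundedness of f^{(p+1)} forces f^{(p)} to converge
at the vertex (`exists_hasBorelImage`). -/

/-! ### The weight in the logarithmic coordinate -/

/-- The function `φ_ω(s) = ω(e^s)`. -/
noncomputable def logWeight (ω : ℝ → ℝ) (s : ℝ) : ℝ := ω (Real.exp s)

section LogWeight

variable {ω : ℝ → ℝ}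

theorem logWeight_nonneg (hω : IsNormalizedWeight ω) (s : ℝ) : 0 ≤ logWeight ω s :=
  hω.nonneg _ (Real.exp_pos s).le

theorem logWeight_mono (hω : IsNormalizedWeight ω) : Monotone (logWeight ω) := fun _ _ h =>
  hω.monotoneOn (Real.exp_pos _).le (Real.exp_pos _).le (Real.exp_le_exp.2 h)

theorem logWeight_of_nonpos (hω : IsNormalizedWeight ω) {s : ℝ} (hs : s ≤ 0) :
    logWeight ω s = 0 :=
  hω.normalized _ ⟨(Real.exp_pos s).le, Real.exp_le_one_iff.2 hs⟩

theorem continuous_logWeight (hω : IsNormalizedWeight ω) : Continuous (logWeight ω) :=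
  hω.continuousOn.comp_continuous Real.continuous_exp fun s => (Real.exp_pos s).le

theorem le_mul_logWeight (h3 : Omega3 ω) (hω : IsNormalizedWeight ω) {c : ℝ} (hc : 0 < c) :
    ∃ s₀, 0 ≤ s₀ ∧ ∀ s, s₀ ≤ s → s ≤ c * logWeight ω s := by
  have h2 := Real.tendsto_exp_atTop.eventually (h3.bound hc)
  obtain ⟨Y, hY⟩ := (h2.and (eventually_ge_atTop 0)).exists_forall_of_atTop
  refine ⟨max Y 0, le_max_right _ _, fun s hs => ?_⟩
  obtain ⟨h, h0⟩ := hY s ((le_max_left _ _).trans hs)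
  rwa [Real.log_exp, Real.norm_of_nonneg h0, Real.norm_of_nonneg (hω.nonneg _ (Real.exp_pos s).le)] at h

theorem integrable_exp_neg_mul_abs {a : ℝ} (ha : 0 < a) :
    MeasureTheory.Integrable fun s : ℝ => Real.exp (-(a * |s|)) := by
  rw [← MeasureTheory.integrableOn_univ, ← Iic_union_Ioi (a := (0 : ℝ))]
  refine MeasureTheory.IntegrableOn.union ?_ ?_
  · refine (integrableOn_exp_mul_Iic ha 0).congr_fun (fun s hs => ?_) measurableSet_Iic
    simp only [abs_of_nonpos (mem_Iic.1 hs)]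
    ring_nf
  · refine (exp_neg_integrableOn_Ioi 0 ha).congr_fun (fun s hs => ?_) measurableSet_Ioi
    simp only [abs_of_pos (mem_Ioi.1 hs)]
    ring_nf

/-- By `(ω₃)`, `e^{as - c φ_ω(s)}` decays exponentially at both ends. -/
theorem integrable_exp_sub_logWeight (hω : IsNormalizedWeight ω) (h3 : Omega3 ω) {a c : ℝ}
    (ha : 0 < a) (hc : 0 < c) :
    MeasureTheory.Integrable fun s : ℝ => Real.exp (a * s - c * logWeight ω s) := by
  -- This constant gives c φ(s) ≥ 2as for s ≥ s₀, so the exponent is at most -a|s| there; the factor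
  -- e^{2as₀} covers [0, s₀].
  obtain ⟨s₀, hs₀, hs⟩ := le_mul_logWeight h3 hω (c := c / (2 * a)) (by positivity)
  refine ((integrable_exp_neg_mul_abs ha).const_mul (Real.exp (2 * a * s₀))).mono' ?_
    (Eventually.of_forall fun s => ?_)
  · exact (Real.continuous_exp.comp ((continuous_const.mul continuous_id).sub
      (continuous_const.mul (continuous_logWeight hω)))).aestronglyMeasurable
  · rw [Real.norm_of_nonneg (Real.exp_pos _).le, ← Real.exp_add, Real.exp_le_exp]
    have h0 := mul_nonneg hc.le (logWeight_nonneg hω s)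
    have h1 : 0 ≤ a * s₀ := by positivity
    rcases le_total s 0 with h | h
    · rw [abs_of_nonpos h]
      linarith
    · rw [abs_of_nonneg h]
      rcases le_total s s₀ with h' | h'
      · have := mul_le_mul_of_nonneg_left h' ha.le
        linarith
      · have h4 := hs s h'
        rw [div_mul_eq_mul_div, le_div_iff₀ (by positivity)] at h4
        linarith

/-- The growth property bounds `φ_ω` by an exponential of rate less than `1/γ`. -/
theorem logWeight_add_le (hω : IsNormalizedWeight ω) {γ : ℝ} (hγ : 0 < γ)
    (h : GrowthProperty ω γ) :
    ∃ A β D : ℝ, 0 ≤ A ∧ 0 ≤ β ∧ β < 1 / γ ∧ 0 ≤ D ∧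
      ∀ s u, 0 ≤ u → logWeight ω (s + u) ≤ A * Real.exp (β * u) * (logWeight ω s + D) := by
  obtain ⟨K, hK, hlim⟩ := h
  -- The maximum with 1 makes K' > 1, so that the rate log K' / (γ log K) is nonnegative; K' < K
  -- makes it less than 1/γ.
  have hlim' : max 1 (limsup (fun t : ℝ => ((ω (K ^ γ * t) / ω t : ℝ) : EReal)) atTop) <
      (K : EReal) := max_lt (by exact_mod_cast hK) hlim
  obtain ⟨K', hK1, hK2⟩ := EReal.lt_iff_exists_real_btwn.1 hlim'
  have hK'1 : 1 < K' := by exact_mod_cast (le_max_left _ _).trans_lt hK1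
  have hK'K : K' < K := by exact_mod_cast hK2
  have hev := eventually_lt_of_limsup_lt ((le_max_right _ _).trans_lt hK1)
  have hev2 := Real.tendsto_exp_atTop.eventually
    (hev.and (hω.tendsto_atTop.eventually (eventually_gt_atTop 0)))
  obtain ⟨s₀, hs₀⟩ := hev2.exists_forall_of_atTop
  -- Multiplying t by K^γ is the translation by L in the logarithmic coordinate.
  set L : ℝ := γ * Real.log K with hL
  have hlogK : 0 < Real.log K := Real.log_pos hK
  have hLpos : 0 < L := mul_pos hγ hlogK
  have hlogK' : 0 < Real.log K' := Real.log_pos hK'1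
  have step : ∀ s, s₀ ≤ s → logWeight ω (s + L) ≤ K' * logWeight ω s := by
    intro s hs
    obtain ⟨h1, h2⟩ := hs₀ s hs
    have h1' : ω (K ^ γ * Real.exp s) / ω (Real.exp s) < K' := by exact_mod_cast h1
    have h3 : K ^ γ * Real.exp s = Real.exp (s + L) := by
      rw [Real.rpow_def_of_pos (by linarith), ← Real.exp_add, hL]
      congr 1; ring
    rw [h3, div_lt_iff₀ h2] at h1'
    exact h1'.le
  have steps : ∀ n : ℕ, ∀ s, s₀ ≤ s → logWeight ω (s + n * L) ≤ K' ^ n * logWeight ω s := by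
    intro n
    induction n with
    | zero => intro s _; simp
    | succ n ih =>
      intro s hs
      have h1 := step (s + n * L) (by nlinarith [(Nat.cast_nonneg n : (0 : ℝ) ≤ n)])
      have h2 := ih s hs
      have : s + ((n + 1 : ℕ) : ℝ) * L = s + n * L + L := by push_cast; ring
      rw [this, pow_succ']
      nlinarith
  have large : ∀ s u, s₀ ≤ s → 0 ≤ u →
      logWeight ω (s + u) ≤ K' * Real.exp (Real.log K' / L * u) * logWeight ω s := by
    intro s u hs hu
    have h1 : u ≤ ⌈u / L⌉₊ * L := by
      rw [← div_le_iff₀ hLpos]; exact Nat.le_ceil _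
    have h2 := logWeight_mono hω (add_le_add_right h1 s)
    refine (h2.trans (steps _ s hs)).trans
      (mul_le_mul_of_nonneg_right ?_ (logWeight_nonneg hω s))
    have h4 : ((⌈u / L⌉₊ : ℕ) : ℝ) ≤ u / L + 1 := (Nat.ceil_lt_add_one (by positivity)).le
    rw [← Real.rpow_natCast, Real.rpow_def_of_pos (by linarith)]
    nth_rewrite 2 [← Real.exp_log (show 0 < K' by linarith)]
    rw [← Real.exp_add, Real.exp_le_exp]
    calc Real.log K' * (⌈u / L⌉₊ : ℕ) ≤ Real.log K' * (u / L + 1) :=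
          mul_le_mul_of_nonneg_left h4 hlogK'.le
      _ = _ := by ring
  -- The constant D = φ(s₀) takes care of s < s₀, where φ(s+u) ≤ φ(s₀+u) by monotonicity.
  refine ⟨K', Real.log K' / L, logWeight ω s₀, by linarith, by positivity, ?_,
    logWeight_nonneg hω _, fun s u hu => ?_⟩
  · rw [div_lt_div_iff₀ hLpos hγ, hL]
    have := Real.log_lt_log (by linarith) hK'K
    nlinarith
  · have hp : 0 ≤ K' * Real.exp (Real.log K' / L * u) := by positivity
    rcases le_total s₀ s with hs | hs
    · exact (large s u hs hu).trans (mul_le_mul_of_nonneg_left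
        (by linarith [logWeight_nonneg hω s₀]) hp)
    · exact ((logWeight_mono hω (add_le_add_left hs u)).trans (large s₀ u le_rfl hu)).trans
        (mul_le_mul_of_nonneg_left (by linarith [logWeight_nonneg hω s]) hp)

theorem exists_growthProperty_of_lt_growthIndex {γ : ℝ}
    (h : ENNReal.ofReal γ < growthIndex ω) : ∃ γ₁, γ < γ₁ ∧ 0 < γ₁ ∧ GrowthProperty ω γ₁ := by
  rw [growthIndex] at h
  obtain ⟨γ₁, h1⟩ := lt_iSup_iff.1 h
  obtain ⟨⟨h2, h3⟩, h4⟩ := lt_iSup_iff.1 h1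
  exact ⟨γ₁, (ENNReal.ofReal_lt_ofReal_iff h2).1 h4, h2, h3⟩

/-! ### The weight matrix -/

theorem weightMatrix_pos (x : ℝ) (p : ℕ) : 0 < weightMatrix ω x p := Real.exp_pos _

theorem exp_sub_logWeight_le_weightMatrix (hω : IsNormalizedWeight ω) (h3 : Omega3 ω) {x : ℝ}
    (hx : 0 < x) (p : ℕ) (s : ℝ) :
    Real.exp (p * s - logWeight ω s / x) ≤ weightMatrix ω x p := by
  rw [weightMatrix, Real.exp_le_exp]
  have h := le_ciSup (bddAbove_youngConj hω.toIsWeightFunction h3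
    (mul_nonneg hx.le (Nat.cast_nonneg p))) s
  have h2 := mul_le_mul_of_nonneg_left h (one_div_pos.2 hx).le
  refine le_trans (le_of_eq ?_) h2
  simp only [logWeight]
  field_simp

/-- T^x_p is the supremum of exp(ps - φ(s)/x) over all real s. For s ≤ 0 the exponent is at most 0,
which is its value at s = 0 by normalization, so only s ≥ 0 has to be tested. -/
theorem weightMatrix_le_of_forall (hω : IsNormalizedWeight ω) {x : ℝ}
    (hx : 0 < x) (p : ℕ) {B : ℝ}
    (h : ∀ s, 0 ≤ s → Real.exp (p * s - logWeight ω s / x) ≤ B) : weightMatrix ω x p ≤ B := by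
  have hB : 0 < B := (Real.exp_pos _).trans_le (h 0 le_rfl)
  rw [weightMatrix, ← Real.le_log_iff_exp_le hB, one_div_mul_eq_div, div_le_iff₀ hx]
  refine ciSup_le fun s => ?_
  rcases le_total 0 s with hs | hs
  · have := (Real.le_log_iff_exp_le hB).2 (h s hs)
    have h2 := mul_le_mul_of_nonneg_right this hx.le
    refine le_trans (le_of_eq ?_) h2
    simp only [logWeight]
    field_simp
  · have := (Real.le_log_iff_exp_le hB).2 (h 0 le_rfl)
    rw [mul_zero, logWeight_of_nonpos hω le_rfl, zero_div, sub_zero] at this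
    have h2 := logWeight_nonneg hω s
    rw [logWeight] at h2
    have h3 : x * p * s ≤ 0 := mul_nonpos_of_nonneg_of_nonpos (by positivity) hs
    nlinarith

end LogWeight

/-! ### Holomorphic convolutions and Cauchy estimates on sectors -/

theorem sub_ofReal_mem_logSector {δ : ℝ} {ζ : ℂ} (hζ : ζ ∈ logSector δ) (s : ℝ) :
    ζ - s ∈ logSector δ := by
  simpa [logSector] using hζ

/-- A dominated convolution on the line with a holomorphic function on a strip is holomorphic. -/
theorem differentiableOn_integral_mul_sub {δ : ℝ} {g : ℂ → ℂ} {c : ℝ → ℂ}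
    (hg : DifferentiableOn ℂ g (logSector δ)) (hc : MeasureTheory.AEStronglyMeasurable c)
    (hb : ∀ ζ₀ ∈ logSector δ, ∃ ε > 0, ∃ B : ℝ → ℝ, MeasureTheory.Integrable B ∧
      ∀ ζ ∈ Metric.ball ζ₀ ε, ζ ∈ logSector δ → ∀ s : ℝ, ‖c s * g (ζ - s)‖ ≤ B s) :
    DifferentiableOn ℂ (fun ζ => ∫ s : ℝ, c s * g (ζ - s)) (logSector δ) := by
  intro ζ₀ hζ₀
  obtain ⟨ε₁, hε₁, B, hB, hbound⟩ := hb ζ₀ hζ₀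
  obtain ⟨ε₂, hε₂, hsub⟩ := Metric.isOpen_iff.1 (isOpen_logSector δ) ζ₀ hζ₀
  -- With a third of the radius, the circles of radius r about points of the r-ball stay where `B`
  -- dominates; Cauchy's inequality then dominates the derivative by `B s / r`.
  set r := min ε₁ ε₂ / 3 with hr
  have hr0 : 0 < r := by have := lt_min hε₁ hε₂; positivity
  have hball : ∀ ζ ∈ Metric.ball ζ₀ r, ∀ w ∈ Metric.closedBall ζ r,
      w ∈ Metric.ball ζ₀ ε₁ ∧ w ∈ logSector δ := by
    intro ζ hζ w hw
    rw [Metric.mem_ball] at hζ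
    rw [Metric.mem_closedBall] at hw
    have h1 := dist_triangle w ζ ζ₀
    have h2 : dist w ζ₀ < min ε₁ ε₂ := by linarith
    exact ⟨Metric.mem_ball.2 (h2.trans_le (min_le_left _ _)),
      hsub (Metric.mem_ball.2 (h2.trans_le (min_le_right _ _)))⟩
  have hself : ∀ ζ : ℂ, ζ ∈ Metric.closedBall ζ r := fun ζ => Metric.mem_closedBall_self hr0.le
  have hcont : ∀ ζ ∈ logSector δ, Continuous fun s : ℝ => g (ζ - s) := fun ζ hζ =>
    hg.continuousOn.comp_continuous (by fun_prop) (sub_ofReal_mem_logSector hζ)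
  have hcont' : Continuous fun s : ℝ => deriv g (ζ₀ - s) :=
    (hg.deriv (isOpen_logSector δ)).continuousOn.comp_continuous (by fun_prop)
      (sub_ofReal_mem_logSector hζ₀)
  have hderiv : ∀ s : ℝ, ∀ ζ ∈ logSector δ,
      HasDerivAt (fun ζ => c s * g (ζ - s)) (c s * deriv g (ζ - s)) ζ := by
    intro s ζ hζ
    have h1 := (hg.differentiableAt ((isOpen_logSector δ).mem_nhds
      (sub_ofReal_mem_logSector hζ s))).hasDerivAt
    exact (h1.comp_sub_const ζ (s : ℂ)).const_mul (c s)
  have hmem : ∀ ζ ∈ Metric.ball ζ₀ r, ζ ∈ logSector δ := fun ζ hζ =>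
    (hball ζ hζ ζ (hself ζ)).2
  refine (hasDerivAt_integral_of_dominated_loc_of_deriv_le (bound := fun s => B s / r)
    (F := fun ζ (s : ℝ) => c s * g (ζ - s)) (F' := fun ζ s => c s * deriv g (ζ - s))
    (Metric.ball_mem_nhds ζ₀ hr0) ?_ ?_ ?_ ?_ (hB.div_const r) ?_).2.differentiableAt.differentiableWithinAt
  · filter_upwards [Metric.ball_mem_nhds ζ₀ hr0] with ζ hζ
    exact hc.mul (hcont ζ (hmem ζ hζ)).aestronglyMeasurable
  · refine hB.mono' (hc.mul (hcont ζ₀ hζ₀).aestronglyMeasurable) (Eventually.of_forall fun s => ?_)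
    exact hbound ζ₀ (Metric.mem_ball_self hε₁) hζ₀ s
  · exact hc.mul hcont'.aestronglyMeasurable
  · refine Eventually.of_forall fun s ζ hζ => ?_
    rw [← (hderiv s ζ (hmem ζ hζ)).deriv]
    refine Complex.norm_deriv_le_of_forall_mem_sphere_norm_le hr0 ?_ fun w hw => ?_
    · refine DifferentiableOn.diffContOnCl_ball (U := logSector δ) (fun w hw => ?_)
        fun w hw => (hball ζ hζ w hw).2
      exact (hderiv s w hw).differentiableAt.differentiableWithinAt
    · obtain ⟨h1, h2⟩ := hball ζ hζ w (Metric.sphere_subset_closedBall hw)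
      exact hbound w h1 h2 s
  · exact Eventually.of_forall fun s ζ hζ => hderiv s ζ (hmem ζ hζ)

/-- The iterated surface derivative in the coordinate `v` with `z = z₀(1+v)`. -/
theorem iteratedDeriv_comp_log {δ : ℝ} {F : ℂ → ℂ} (hF : DifferentiableOn ℂ F (logSector δ))
    {ζ₀ : ℂ} {U : Set ℂ} (hU : IsOpen U)
    (hslit : ∀ v ∈ U, 1 + v ∈ Complex.slitPlane)
    (hmem : ∀ v ∈ U, ζ₀ + Complex.log (1 + v) ∈ logSector δ) (p : ℕ) :
    ∀ v ∈ U, iteratedDeriv p (fun v => F (ζ₀ + Complex.log (1 + v))) v =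
      Complex.exp (p * ζ₀) * surfDeriv^[p] F (ζ₀ + Complex.log (1 + v)) := by
  induction p with
  | zero => intro v _; simp
  | succ p ih =>
    intro v hv
    have hev : iteratedDeriv p (fun v => F (ζ₀ + Complex.log (1 + v))) =ᶠ[𝓝 v]
        fun v => Complex.exp (p * ζ₀) * surfDeriv^[p] F (ζ₀ + Complex.log (1 + v)) := by
      filter_upwards [hU.mem_nhds hv] with w hw using ih w hw
    have h1 := ((differentiableOn_iterate_surfDeriv hF p).differentiableAt
      ((isOpen_logSector δ).mem_nhds (hmem v hv))).hasDerivAt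
    have h2 : HasDerivAt (fun v : ℂ => ζ₀ + Complex.log (1 + v)) (1 / (1 + v)) v :=
      (((hasDerivAt_id v).const_add 1).clog (hslit v hv)).const_add ζ₀
    have h4 : HasDerivAt
        (fun v => Complex.exp (p * ζ₀) * surfDeriv^[p] F (ζ₀ + Complex.log (1 + v))) _ v :=
      (h1.comp v h2).const_mul _
    rw [iteratedDeriv_succ, hev.deriv_eq, h4.deriv,
      Function.iterate_succ_apply', surfDeriv, neg_add, Complex.exp_add, Complex.exp_neg (Complex.log _),
      Complex.exp_log (Complex.slitPlane_ne_zero (hslit v hv))]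
    have h3 : Complex.exp (((p + 1 : ℕ) : ℂ) * ζ₀) * Complex.exp (-ζ₀) = Complex.exp (p * ζ₀) := by
      rw [← Complex.exp_add]; congr 1; push_cast; ring
    rw [← h3]
    ring

/-- Cauchy estimates on a smaller sector. -/
theorem exists_norm_iterate_surfDeriv_le {γ δ : ℝ} (hγδ : γ < δ) :
    ∃ ρ : ℝ, 0 < ρ ∧ ∀ (F : ℂ → ℂ) (A : ℝ) (N : ℕ), DifferentiableOn ℂ F (logSector δ) → 0 ≤ A →
      (∀ ζ ∈ logSector δ, ‖F ζ‖ ≤ A * Real.exp (N * ζ.re)) → ∀ (p : ℕ), ∀ ζ ∈ logSector γ,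
      ‖surfDeriv^[p] F ζ‖ ≤ p.factorial * (A * 2 ^ N) * ρ ^ p * Real.exp ((N - p) * ζ.re) := by
  have hd : 0 < (δ - γ) * Real.pi / 2 := by have := sub_pos.2 hγδ; positivity
  have hcont : ContinuousAt (fun v : ℂ => Complex.arg (1 + v)) 0 := by
    refine ContinuousAt.comp' (f := fun v : ℂ => 1 + v) (x := 0) ?_ (by fun_prop)
    exact Complex.continuousAt_arg (by simp)
  -- For |v| < r the point z₀(1+v) differs in argument from z₀ by less than the gap between the two
  -- half-openings. One relative radius thus serves every z₀ in the smaller sector, by homogeneity.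
  obtain ⟨r, hr, harg⟩ := Metric.continuousAt_iff.1 hcont _ hd
  set ε := min (r / 2) (1 / 2) with hε
  have hε0 : 0 < ε := lt_min (by positivity) (by norm_num)
  have hεr : ε < r := (min_le_left _ _).trans_lt (by linarith)
  have hε1 : ε ≤ 1 / 2 := min_le_right _ _
  set ε' := min r 1 with hε'
  have hεε' : ε < ε' := lt_min hεr (by linarith)
  refine ⟨ε⁻¹, by positivity, fun F A N hF hA hFb p ζ hζ => ?_⟩
  have hslit : ∀ v ∈ Metric.ball (0 : ℂ) ε', 1 + v ∈ Complex.slitPlane := by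
    intro v hv
    refine Complex.mem_slitPlane_of_norm_lt_one ?_
    exact (mem_ball_zero_iff.1 hv).trans_le (min_le_right _ _)
  have hmem : ∀ v ∈ Metric.ball (0 : ℂ) ε', ζ + Complex.log (1 + v) ∈ logSector δ := by
    intro v hv
    have h1 := harg (lt_of_lt_of_le (Metric.mem_ball.1 hv) (min_le_left _ _))
    simp only [add_zero, Complex.arg_one, dist_zero_right, Real.norm_eq_abs] at h1
    change |(ζ + Complex.log (1 + v)).im| < _
    have h2 : |ζ.im| < γ * Real.pi / 2 := hζ
    rw [Complex.add_im, Complex.log_im]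
    have := abs_add_le ζ.im (Complex.arg (1 + v))
    linarith
  have hkey := iteratedDeriv_comp_log hF Metric.isOpen_ball hslit hmem p 0 (by simp; positivity)
  rw [add_zero, Complex.log_one, add_zero] at hkey
  have hdiff : DifferentiableOn ℂ (fun v => F (ζ + Complex.log (1 + v))) (Metric.ball 0 ε') := by
    intro v hv
    refine DifferentiableAt.differentiableWithinAt ?_
    have h1 := hF.differentiableAt ((isOpen_logSector δ).mem_nhds (hmem v hv))
    have h2 : DifferentiableAt ℂ (fun v : ℂ => ζ + Complex.log (1 + v)) v :=
      (((differentiableAt_id).const_add 1).clog (hslit v hv)).const_add ζ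
    exact h1.comp v h2
  have hcl : Metric.closedBall (0 : ℂ) ε ⊆ Metric.ball 0 ε' :=
    Metric.closedBall_subset_ball hεε'
  have hC := Complex.norm_iteratedDeriv_le_of_forall_mem_sphere_norm_le (c := 0) (R := ε)
    (C := A * (Real.exp (N * ζ.re) * 2 ^ N)) p hε0 (hdiff.diffContOnCl_ball hcl) (fun v hv => by
      have hv' := hcl (Metric.sphere_subset_closedBall hv)
      refine (hFb _ (hmem v hv')).trans (mul_le_mul_of_nonneg_left ?_ hA)
      -- On the circle |z| ≤ 2|z₀|, which is the source of the factor 2^N.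
      have hn : ‖1 + v‖ ≤ 2 := by
        refine (norm_add_le _ _).trans ?_
        rw [mem_sphere_zero_iff_norm.1 hv, norm_one]; linarith
      have hn0 : 0 < ‖1 + v‖ := norm_pos_iff.2 (Complex.slitPlane_ne_zero (hslit v hv'))
      rw [Complex.add_re, Complex.log_re, mul_add, Real.exp_add]
      refine mul_le_mul_of_nonneg_left ?_ (Real.exp_pos _).le
      rw [← Real.log_pow, Real.exp_log (by positivity)]
      gcongr)
  rw [hkey, norm_mul, Complex.norm_exp] at hC
  have hre : ((p : ℂ) * ζ).re = p * ζ.re := by simp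
  rw [hre] at hC
  have hexp : Real.exp ((N - p) * ζ.re) = Real.exp (N * ζ.re) / Real.exp (p * ζ.re) := by
    rw [← Real.exp_sub]; ring_nf
  rw [hexp, inv_pow]
  rw [mul_comm, ← le_div_iff₀ (Real.exp_pos _)] at hC
  refine hC.trans (le_of_eq ?_)
  field_simp

theorem convex_logSector (δ : ℝ) : Convex ℝ (logSector δ) := by
  have : logSector δ = Complex.imCLM ⁻¹' (Metric.ball 0 (δ * Real.pi / 2)) := by
    ext w; simp [logSector]
  rw [this]
  exact (convex_ball _ _).affine_preimage Complex.imCLM.toLinearMap.toAffineMap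

/-- A holomorphic function on a sector that is invariant under dilations is constant. -/
theorem eqOn_of_forall_add_ofReal {δ : ℝ} {Φ : ℂ → ℂ} (hΦ : DifferentiableOn ℂ Φ (logSector δ))
    (hinv : ∀ (ζ : ℂ) (t : ℝ), Φ (ζ + t) = Φ ζ) {ζ : ℂ} (hζ : ζ ∈ logSector δ) : Φ ζ = Φ 0 := by
  have h0 : (0 : ℂ) ∈ logSector δ := by
    have h : |ζ.im| < δ * Real.pi / 2 := hζ
    simpa [logSector] using (abs_nonneg _).trans_lt h
  refine (isOpen_logSector δ).is_const_of_deriv_eq_zero (convex_logSector δ).isPreconnected hΦ (fun w hw => ?_)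
    hζ h0
  have h1 := (hΦ.differentiableAt ((isOpen_logSector δ).mem_nhds hw)).hasDerivAt
  -- A holomorphic function has zero complex derivative as soon as its derivative in the real
  -- direction vanishes.
  have h2 : HasDerivAt (fun t : ℝ => w + (t : ℂ)) 1 0 :=
    (Complex.ofRealCLM.hasDerivAt (x := (0 : ℝ))).const_add w |>.congr_deriv (by simp)
  have h3 : HasDerivAt (fun t : ℝ => Φ (w + t)) (deriv Φ w * 1) 0 := by
    have h1' : HasDerivAt Φ (deriv Φ w) (w + ((0 : ℝ) : ℂ)) := by simpa using h1
    exact h1'.comp (0 : ℝ) h2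
  have h4 : (fun t : ℝ => Φ (w + t)) = fun _ => Φ w := funext fun t => hinv w t
  rw [h4, mul_one] at h3
  exact h3.unique (hasDerivAt_const _ _)

/-! ### A holomorphic function comparable with the weight -/

/-- The kernel `b / (4 cosh² (b w / 2))`, of total mass one on the line. -/
noncomputable def coshKernel (b : ℝ) (w : ℂ) : ℂ :=
  b / (2 + Complex.exp (b * w) + Complex.exp (-(b * w)))

section Kernel

variable {b δ : ℝ}

/-- As bδ < 1, the number b Im w stays in a compact part of (-π/2, π/2), where the cosine is bounded
below by a positive constant. This is the source of the nonvanishing denominator, the nonnegative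
real part and the exponential decay of the kernel. -/
theorem cos_le_cos_im (hb : 0 < b) (hbδ : b * δ < 1) {w : ℂ} (hw : w ∈ logSector δ) :
    Real.cos (b * δ * (Real.pi / 2)) ≤ Real.cos (b * w.im) := by
  have hw' : |w.im| < δ * Real.pi / 2 := hw
  rw [← Real.cos_abs (b * w.im), abs_mul, abs_of_pos hb]
  refine Real.cos_le_cos_of_nonneg_of_le_pi (by positivity) ?_ ?_
  · nlinarith [Real.pi_pos]
  · nlinarith

theorem cos_pos_of_mul_lt_one (hb : 0 < b) (hδ : 0 < δ) (hbδ : b * δ < 1) :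
    0 < Real.cos (b * δ * (Real.pi / 2)) := by
  refine Real.cos_pos_of_mem_Ioo ⟨?_, ?_⟩
  · have : 0 < b * δ * (Real.pi / 2) := by positivity
    linarith [Real.pi_pos]
  · nlinarith [Real.pi_pos]

theorem re_coshKernel_denom (w : ℂ) :
    (2 + Complex.exp (b * w) + Complex.exp (-(b * w))).re =
      2 + (Real.exp (b * w.re) + Real.exp (-(b * w.re))) * Real.cos (b * w.im) := by
  simp [Complex.exp_re]
  ring

theorem le_re_coshKernel_denom (hb : 0 < b) (hδ : 0 < δ) (hbδ : b * δ < 1) {w : ℂ}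
    (hw : w ∈ logSector δ) :
    Real.cos (b * δ * (Real.pi / 2)) * Real.exp (b * |w.re|) ≤
      (2 + Complex.exp (b * w) + Complex.exp (-(b * w))).re := by
  rw [re_coshKernel_denom]
  have h1 := cos_le_cos_im hb hbδ hw
  have h2 := cos_pos_of_mul_lt_one hb hδ hbδ
  have h3 : Real.exp (b * |w.re|) ≤ Real.exp (b * w.re) + Real.exp (-(b * w.re)) := by
    rcases abs_cases w.re with h | h <;> rw [h.1]
    · linarith [Real.exp_pos (-(b * w.re))]
    · rw [mul_neg]; linarith [Real.exp_pos (b * w.re)]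
  have h4 := mul_le_mul h1 h3 (Real.exp_pos _).le (h2.le.trans h1)
  linarith

theorem coshKernel_denom_re_pos (hb : 0 < b) (hδ : 0 < δ) (hbδ : b * δ < 1) {w : ℂ}
    (hw : w ∈ logSector δ) : 0 < (2 + Complex.exp (b * w) + Complex.exp (-(b * w))).re :=
  (mul_pos (cos_pos_of_mul_lt_one hb hδ hbδ) (Real.exp_pos _)).trans_le
    (le_re_coshKernel_denom hb hδ hbδ hw)

theorem coshKernel_denom_ne_zero (hb : 0 < b) (hδ : 0 < δ) (hbδ : b * δ < 1) {w : ℂ}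
    (hw : w ∈ logSector δ) : 2 + Complex.exp (b * w) + Complex.exp (-(b * w)) ≠ 0 := by
  intro h
  have := coshKernel_denom_re_pos hb hδ hbδ hw
  rw [h] at this
  simp at this

theorem differentiableOn_coshKernel (hb : 0 < b) (hδ : 0 < δ) (hbδ : b * δ < 1) :
    DifferentiableOn ℂ (coshKernel b) (logSector δ) :=
  DifferentiableOn.div (by fun_prop) (by fun_prop)
    fun _ hw => coshKernel_denom_ne_zero hb hδ hbδ hw

theorem re_coshKernel_nonneg (hb : 0 < b) (hδ : 0 < δ) (hbδ : b * δ < 1) {w : ℂ}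
    (hw : w ∈ logSector δ) : 0 ≤ (coshKernel b w).re := by
  rw [coshKernel, Complex.div_re, Complex.ofReal_re, Complex.ofReal_im, zero_mul, zero_div,
    add_zero]
  exact div_nonneg (mul_pos hb (coshKernel_denom_re_pos hb hδ hbδ hw)).le (Complex.normSq_nonneg _)

theorem norm_coshKernel_le (hb : 0 < b) (hδ : 0 < δ) (hbδ : b * δ < 1) {w : ℂ}
    (hw : w ∈ logSector δ) :
    ‖coshKernel b w‖ ≤ b / Real.cos (b * δ * (Real.pi / 2)) * Real.exp (-(b * |w.re|)) := by
  have hc := cos_pos_of_mul_lt_one hb hδ hbδ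
  rw [coshKernel, norm_div, Complex.norm_real, Real.norm_of_nonneg hb.le, Real.exp_neg,
    ← div_eq_mul_inv, div_div]
  exact div_le_div_of_nonneg_left hb.le (by positivity)
    ((le_re_coshKernel_denom hb hδ hbδ hw).trans (Complex.re_le_norm _))

theorem coshKernel_ofReal (r : ℝ) :
    coshKernel b r = ((b / (2 + Real.exp (b * r) + Real.exp (-(b * r))) : ℝ) : ℂ) := by
  simp [coshKernel]

theorem one_add_exp_ne_zero (hb : 0 < b) (hδ : 0 < δ) (hbδ : b * δ < 1) {w : ℂ}
    (hw : w ∈ logSector δ) : 1 + Complex.exp (b * w) ≠ 0 := by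
  intro h
  refine coshKernel_denom_ne_zero hb hδ hbδ hw ?_
  have h1 : Complex.exp (b * w) = -1 := by linear_combination h
  rw [Complex.exp_neg, h1]
  norm_num

/-- With E = e^{b(w-s)} the kernel equals bE/(1+E)², the derivative of a logistic function; its
masses can therefore be computed exactly. -/
theorem hasDerivAt_coshKernel_primitive (hb : 0 < b) (hδ : 0 < δ) (hbδ : b * δ < 1) {w : ℂ}
    (hw : w ∈ logSector δ) (s : ℝ) :
    HasDerivAt (fun s : ℝ => (1 + Complex.exp (b * (w - s)))⁻¹) (coshKernel b (w - s)) s := by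
  have hne := one_add_exp_ne_zero hb hδ hbδ (sub_ofReal_mem_logSector hw s)
  have h1 : HasDerivAt (fun s : ℝ => (b : ℂ) * (w - s)) (b * (-1)) s :=
    (((Complex.ofRealCLM.hasDerivAt (x := s)).const_sub w).const_mul (b : ℂ)).congr_deriv
      (by simp)
  refine ((h1.cexp.const_add 1).inv hne).congr_deriv ?_
  rw [coshKernel, Complex.exp_neg]
  have he := Complex.exp_ne_zero (b * (w - s))
  set E := Complex.exp (b * (w - s))
  have hd : 2 + E + E⁻¹ = (1 + E) ^ 2 / E := by field_simp; ring
  rw [hd]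
  field_simp

theorem integrable_coshKernel (hb : 0 < b) (hδ : 0 < δ) (hbδ : b * δ < 1) {w : ℂ}
    (hw : w ∈ logSector δ) :
    MeasureTheory.Integrable fun s : ℝ => coshKernel b (w - s) := by
  refine ((integrable_exp_neg_mul_abs hb).comp_sub_left w.re |>.const_mul
    (b / Real.cos (b * δ * (Real.pi / 2)))).mono' ?_ (Eventually.of_forall fun s => ?_)
  · exact ((differentiableOn_coshKernel hb hδ hbδ).continuousOn.comp_continuous (by fun_prop)
      (sub_ofReal_mem_logSector hw)).aestronglyMeasurable
  · simpa using norm_coshKernel_le hb hδ hbδ (sub_ofReal_mem_logSector hw s)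

theorem tendsto_coshKernel_primitive (hb : 0 < b) (w : ℂ) :
    Tendsto (fun s : ℝ => (1 + Complex.exp (b * (w - s)))⁻¹) atTop (𝓝 1) := by
  have h : Tendsto (fun s : ℝ => Complex.exp (b * (w - s))) atTop (𝓝 0) := by
    rw [tendsto_zero_iff_norm_tendsto_zero]
    simp only [Complex.norm_exp, Complex.mul_re, Complex.ofReal_re, Complex.ofReal_im, zero_mul,
      sub_zero, Complex.sub_re]
    refine Real.tendsto_exp_atBot.comp (Tendsto.const_mul_atBot hb ?_)
    exact tendsto_atBot_add_const_left _ _ tendsto_neg_atTop_atBot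
  simpa using (h.const_add 1).inv₀ (by simp)

/-- The half mass of the kernel on a horizontal line. -/
theorem re_setIntegral_coshKernel (hb : 0 < b) (hδ : 0 < δ) (hbδ : b * δ < 1) {w : ℂ}
    (hw : w ∈ logSector δ) :
    (∫ s : ℝ in Ioi w.re, coshKernel b (w - s)).re = 1 / 2 := by
  rw [MeasureTheory.integral_Ioi_of_hasDerivAt_of_tendsto'
    (fun s _ => hasDerivAt_coshKernel_primitive hb hδ hbδ hw s)
    (integrable_coshKernel hb hδ hbδ hw).integrableOn (tendsto_coshKernel_primitive hb w)]
  have hne := one_add_exp_ne_zero hb hδ hbδ (sub_ofReal_mem_logSector hw w.re)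
  -- At the endpoint s = Re w the exponential has modulus one, and 1/(1+e^{iθ}) has real part 1/2.
  have he : Complex.exp (b * (w - w.re)) = Complex.exp ((b * w.im : ℝ) * Complex.I) := by
    congr 1
    nth_rewrite 1 [← Complex.re_add_im w]
    push_cast; ring
  rw [he] at hne ⊢
  rw [Complex.sub_re, Complex.inv_re, Complex.one_re, Complex.add_re, Complex.one_re,
    Complex.exp_ofReal_mul_I_re]
  have hn : Complex.normSq (1 + Complex.exp ((b * w.im : ℝ) * Complex.I)) =
      2 * (1 + Real.cos (b * w.im)) := by
    rw [Complex.normSq_apply, Complex.add_re, Complex.add_im, Complex.exp_ofReal_mul_I_re,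
      Complex.exp_ofReal_mul_I_im, Complex.one_re, Complex.one_im]
    nlinarith [Real.sin_sq_add_cos_sq (b * w.im)]
  have hn0 := Complex.normSq_pos.2 hne
  rw [hn] at hn0 ⊢
  have : 1 + Real.cos (b * w.im) ≠ 0 := by linarith
  field_simp
  norm_num

theorem integral_coshKernel (hb : 0 < b) (hδ : 0 < δ) (hbδ : b * δ < 1) (r : ℝ) :
    ∫ s : ℝ, coshKernel b (r - s) = 1 := by
  have hr : (r : ℂ) ∈ logSector δ := by
    simp only [logSector, mem_ofPred_eq, Complex.ofReal_im, abs_zero]; positivity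
  rw [MeasureTheory.integral_of_hasDerivAt_of_tendsto (m := 0)
    (fun s => hasDerivAt_coshKernel_primitive hb hδ hbδ hr s)
    (integrable_coshKernel hb hδ hbδ hr) ?_ (tendsto_coshKernel_primitive hb r), sub_zero]
  rw [tendsto_zero_iff_norm_tendsto_zero]
  have h : Tendsto (fun s : ℝ => (1 + Real.exp (b * (r - s)))⁻¹) atBot (𝓝 0) := by
    refine tendsto_inv_atTop_zero.comp (tendsto_atTop_add_const_left _ _
      (Real.tendsto_exp_atTop.comp (Tendsto.const_mul_atTop hb ?_)))
    exact tendsto_atTop_add_const_left _ _ tendsto_neg_atBot_atTop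
  refine h.congr fun s => ?_
  have : (1 + Complex.exp (b * (r - s)))⁻¹ = (((1 + Real.exp (b * (r - s)))⁻¹ : ℝ) : ℂ) := by
    push_cast; rfl
  rw [this, Complex.norm_real, Real.norm_of_nonneg (by positivity)]

end Kernel

/-! ### Convolution of the weight with the kernel -/

section HolomorphicWeight

variable {ω : ℝ → ℝ} {b β A D δ : ℝ}

theorem logWeight_le_exp_abs (hω : IsNormalizedWeight ω)
    (hgrowth : ∀ s u, 0 ≤ u → logWeight ω (s + u) ≤ A * Real.exp (β * u) * (logWeight ω s + D))
    (s : ℝ) : logWeight ω s ≤ A * D * Real.exp (β * |s|) := by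
  have h1 := logWeight_mono hω (le_abs_self s)
  have h2 := hgrowth 0 |s| (abs_nonneg s)
  rw [zero_add, logWeight_of_nonpos hω le_rfl] at h2
  linarith

/-- Exponential domination of the convolution of the weight with the kernel. -/
theorem norm_logWeight_mul_coshKernel_le (hω : IsNormalizedWeight ω) (hδ : 0 < δ) (hb : 0 < b)
    (hbδ : b * δ < 1) (hAD : 0 ≤ A * D)
    (hgrowth : ∀ s u, 0 ≤ u → logWeight ω (s + u) ≤ A * Real.exp (β * u) * (logWeight ω s + D))
    {ζ : ℂ} (hζ : ζ ∈ logSector δ) {a : ℝ} (ha : |ζ.re| ≤ a) (s : ℝ) :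
    ‖(logWeight ω s : ℂ) * coshKernel b (ζ - s)‖ ≤
      A * D * (b / Real.cos (b * δ * (Real.pi / 2))) * Real.exp (b * a) *
        Real.exp (-((b - β) * |s|)) := by
  have hc := cos_pos_of_mul_lt_one hb hδ hbδ
  rw [norm_mul, Complex.norm_real, Real.norm_of_nonneg (logWeight_nonneg hω s)]
  have h1 := norm_coshKernel_le hb hδ hbδ (sub_ofReal_mem_logSector hζ s)
  have h2 := mul_le_mul (logWeight_le_exp_abs hω hgrowth s) h1 (norm_nonneg _) (by positivity)
  refine h2.trans ?_
  have h3 : Real.exp (β * |s|) * Real.exp (-(b * |(ζ - s).re|)) ≤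
      Real.exp (b * a) * Real.exp (-((b - β) * |s|)) := by
    rw [← Real.exp_add, ← Real.exp_add, Real.exp_le_exp]
    have h4 : |s| ≤ |ζ.re| + |(ζ - s).re| := by
      rw [Complex.sub_re, Complex.ofReal_re]
      have := abs_sub_abs_le_abs_sub s ζ.re
      rw [abs_sub_comm] at this
      linarith
    nlinarith
  calc _ = A * D * (b / Real.cos (b * δ * (Real.pi / 2))) *
        (Real.exp (β * |s|) * Real.exp (-(b * |(ζ - s).re|))) := by ring
    _ ≤ A * D * (b / Real.cos (b * δ * (Real.pi / 2))) *
        (Real.exp (b * a) * Real.exp (-((b - β) * |s|))) :=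
      mul_le_mul_of_nonneg_left h3 (by positivity)
    _ = _ := by ring

/-- Convolve φ with the kernel. Its real part is nonnegative with mass 1/2 on s > Re ζ, where φ(s) ≥
φ(Re ζ); this gives the lower bound. On the real line the total mass is one, and since β < b the
part beyond r + k is small for large k; this gives the upper bound. The shift k is harmless, as it
costs only a geometric factor in the moments. -/
theorem exists_holomorphic_comparable (hω : IsNormalizedWeight ω) (hδ : 0 < δ) (hβ : 0 ≤ β)
    (hβb : β < b) (hbδ : b * δ < 1) (hA : 0 ≤ A) (hD : 0 ≤ D)
    (hgrowth : ∀ s u, 0 ≤ u →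
      logWeight ω (s + u) ≤ A * Real.exp (β * u) * (logWeight ω s + D)) :
    ∃ (q : ℂ → ℂ) (k C : ℝ), DifferentiableOn ℂ q (logSector δ) ∧
      (∀ ζ ∈ logSector δ, logWeight ω ζ.re ≤ 3 * (q ζ).re) ∧
      ∀ s : ℝ, (q s).im = 0 ∧ (q s).re ≤ logWeight ω (s + k) + C := by
  have hb : 0 < b := hβ.trans_lt hβb
  have hbβ : 0 < b - β := sub_pos.2 hβb
  have hAD : 0 ≤ A * D := mul_nonneg hA hD
  have hint := integrable_exp_neg_mul_abs hbβ
  set q₀ : ℂ → ℂ := fun ζ => ∫ s : ℝ, (logWeight ω s : ℂ) * coshKernel b (ζ - s) with hq₀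
  have hmeas : MeasureTheory.AEStronglyMeasurable fun s : ℝ => (logWeight ω s : ℂ) :=
    (Complex.continuous_ofReal.comp (continuous_logWeight hω)).aestronglyMeasurable
  have hqd : DifferentiableOn ℂ q₀ (logSector δ) := by
    refine differentiableOn_integral_mul_sub (differentiableOn_coshKernel hb hδ hbδ) hmeas
      fun ζ₀ _ => ⟨1, one_pos, _, hint.const_mul (A * D * (b / Real.cos (b * δ * (Real.pi / 2))) *
        Real.exp (b * (|ζ₀.re| + 1))), fun ζ hζ hζδ s => ?_⟩
    refine norm_logWeight_mul_coshKernel_le hω hδ hb hbδ hAD hgrowth hζδ ?_ s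
    have h1 : |(ζ - ζ₀).re| ≤ ‖ζ - ζ₀‖ := Complex.abs_re_le_norm _
    rw [Metric.mem_ball, dist_eq_norm] at hζ
    rw [Complex.sub_re] at h1
    have := abs_sub_abs_le_abs_sub ζ.re ζ₀.re
    linarith
  have hqint : ∀ ζ ∈ logSector δ,
      MeasureTheory.Integrable fun s : ℝ => (logWeight ω s : ℂ) * coshKernel b (ζ - s) := by
    intro ζ hζ
    refine (hint.const_mul (A * D * (b / Real.cos (b * δ * (Real.pi / 2))) *
        Real.exp (b * |ζ.re|))).mono' (hmeas.mul
          (integrable_coshKernel hb hδ hbδ hζ).aestronglyMeasurable)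
        (Eventually.of_forall fun s => ?_)
    exact norm_logWeight_mul_coshKernel_le hω hδ hb hbδ hAD hgrowth hζ le_rfl s
  have hre : ∀ ζ ∈ logSector δ,
      (q₀ ζ).re = ∫ s : ℝ, logWeight ω s * (coshKernel b (ζ - s)).re := by
    intro ζ hζ
    have := Complex.reCLM.integral_comp_comm (hqint ζ hζ)
    simp only [Complex.reCLM_apply, Complex.re_ofReal_mul] at this
    exact this.symm
  have hreint : ∀ ζ ∈ logSector δ,
      MeasureTheory.Integrable fun s : ℝ => logWeight ω s * (coshKernel b (ζ - s)).re := by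
    intro ζ hζ
    have := Complex.reCLM.integrable_comp (hqint ζ hζ)
    simpa only [Function.comp_def, Complex.reCLM_apply, Complex.re_ofReal_mul] using this
  have hKint : ∀ ζ ∈ logSector δ,
      MeasureTheory.Integrable fun s : ℝ => (coshKernel b (ζ - s)).re := fun ζ hζ =>
    Complex.reCLM.integrable_comp (integrable_coshKernel hb hδ hbδ hζ)
  have hlower : ∀ ζ ∈ logSector δ, logWeight ω ζ.re * (1 / 2) ≤ (q₀ ζ).re := by
    intro ζ hζ
    have h1 := re_setIntegral_coshKernel hb hδ hbδ hζ
    have h2 := Complex.reCLM.integral_comp_comm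
      (integrable_coshKernel hb hδ hbδ hζ).integrableOn (μ := MeasureTheory.volume.restrict
        (Ioi ζ.re))
    simp only [Complex.reCLM_apply] at h2
    rw [hre ζ hζ, ← h1, ← h2, ← MeasureTheory.integral_const_mul]
    refine le_trans (MeasureTheory.setIntegral_mono_on ((hKint ζ hζ).const_mul _).integrableOn
      (hreint ζ hζ).integrableOn measurableSet_Ioi fun s hs => ?_)
      (MeasureTheory.setIntegral_le_integral (hreint ζ hζ) (Eventually.of_forall fun s => ?_))
    · exact mul_le_mul_of_nonneg_right (logWeight_mono hω (le_of_lt hs))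
        (re_coshKernel_nonneg hb hδ hbδ (sub_ofReal_mem_logSector hζ s))
    · exact mul_nonneg (logWeight_nonneg hω s)
        (re_coshKernel_nonneg hb hδ hbδ (sub_ofReal_mem_logSector hζ s))
  set I := ∫ s : ℝ, Real.exp (-((b - β) * |s|)) with hI
  -- The part of the integral over s > r + k is at most A b I e^{-bk} (φ(r+k) + D), and k makes this
  -- at most half of φ(r+k) + D.
  obtain ⟨k, hk⟩ : ∃ k : ℝ, A * b * I * Real.exp (-(b * k)) ≤ 1 / 2 := by
    have h1 : Tendsto (fun k : ℝ => A * b * I * Real.exp (-(b * k))) atTop (𝓝 (A * b * I * 0)) :=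
      (Real.tendsto_exp_neg_atTop_nhds_zero.comp
        (tendsto_id.const_mul_atTop hb)).const_mul _
    rw [mul_zero] at h1
    exact (h1.eventually_le_const (by norm_num)).exists
  have hrealmem : ∀ r : ℝ, (r : ℂ) ∈ logSector δ := fun r => by
    simp only [logSector, mem_ofPred_eq, Complex.ofReal_im, abs_zero]; positivity
  have hupper : ∀ r : ℝ, (q₀ r).re ≤ 3 / 2 * logWeight ω (r + k) + D / 2 := by
    intro r
    set W := logWeight ω (r + k) with hW
    have hW0 : 0 ≤ W := logWeight_nonneg hω _
    have hshift : MeasureTheory.Integrable fun s : ℝ =>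
        Real.exp (-((b - β) * |s - (r + k)|)) := hint.comp_sub_right (r + k)
    have hshiftI : ∫ s : ℝ, Real.exp (-((b - β) * |s - (r + k)|)) = I :=
      MeasureTheory.integral_sub_right_eq_self
        (fun s : ℝ => Real.exp (-((b - β) * |s|))) (r + k)
    have hmass : ∫ s : ℝ, (coshKernel b (r - s)).re = 1 := by
      have := Complex.reCLM.integral_comp_comm (integrable_coshKernel hb hδ hbδ (hrealmem r))
      simp only [Complex.reCLM_apply] at this
      rw [this, integral_coshKernel hb hδ hbδ, Complex.one_re]
    have hpt : ∀ s : ℝ, logWeight ω s * (coshKernel b (r - s)).re ≤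
        W * (coshKernel b (r - s)).re + A * (W + D) * b * Real.exp (-(b * k)) *
          Real.exp (-((b - β) * |s - (r + k)|)) := by
      intro s
      have hK0 := re_coshKernel_nonneg hb hδ hbδ (sub_ofReal_mem_logSector (hrealmem r) s)
      rcases le_total s (r + k) with hs | hs
      · have := mul_le_mul_of_nonneg_right (logWeight_mono hω hs) hK0
        have : 0 ≤ A * (W + D) * b * Real.exp (-(b * k)) *
          Real.exp (-((b - β) * |s - (r + k)|)) := by positivity
        linarith
      · have h1 := hgrowth (r + k) (s - (r + k)) (sub_nonneg.2 hs)
        rw [add_sub_cancel] at h1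
        have h2 : (coshKernel b (r - s)).re ≤ b * Real.exp (-(b * (s - r))) := by
          rw [← Complex.ofReal_sub, coshKernel_ofReal, Complex.ofReal_re,
            Real.exp_neg (b * (s - r)), ← div_eq_mul_inv]
          refine div_le_div_of_nonneg_left hb.le (Real.exp_pos _) ?_
          have : b * (s - r) = -(b * (r - s)) := by ring
          rw [this]
          linarith [Real.exp_pos (b * (r - s))]
        have h3 := mul_le_mul h1 h2 hK0 (by positivity)
        have h4 : Real.exp (β * (s - (r + k))) * Real.exp (-(b * (s - r))) =
            Real.exp (-(b * k)) * Real.exp (-((b - β) * |s - (r + k)|)) := by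
          rw [abs_of_nonneg (sub_nonneg.2 hs), ← Real.exp_add, ← Real.exp_add]
          congr 1; ring
        have h5 : A * Real.exp (β * (s - (r + k))) * (W + D) * (b * Real.exp (-(b * (s - r)))) =
            A * (W + D) * b * Real.exp (-(b * k)) *
              Real.exp (-((b - β) * |s - (r + k)|)) := by
          linear_combination A * (W + D) * b * h4
        rw [h5] at h3
        have : 0 ≤ W * (coshKernel b (r - s)).re := mul_nonneg hW0 hK0
        linarith
    rw [hre r (hrealmem r)]
    refine (MeasureTheory.integral_mono (hreint r (hrealmem r))
      (((hKint r (hrealmem r)).const_mul W).add (hshift.const_mul _)) hpt).trans ?_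
    rw [MeasureTheory.integral_add' ((hKint r (hrealmem r)).const_mul W) (hshift.const_mul _),
      MeasureTheory.integral_const_mul, MeasureTheory.integral_const_mul, hshiftI, hmass]
    have : (A * b * I * Real.exp (-(b * k))) * (W + D) ≤ 1 / 2 * (W + D) :=
      mul_le_mul_of_nonneg_right hk (by linarith)
    linarith
  have him : ∀ r : ℝ, (q₀ r).im = 0 := by
    intro r
    have : q₀ r = ((∫ s : ℝ, logWeight ω s *
        (b / (2 + Real.exp (b * (r - s)) + Real.exp (-(b * (r - s))))) : ℝ) : ℂ) := by
      rw [hq₀, ← integral_complex_ofReal]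
      refine MeasureTheory.integral_congr_ae (Eventually.of_forall fun s => ?_)
      simp only
      rw [← Complex.ofReal_sub, coshKernel_ofReal, ← Complex.ofReal_mul]
    rw [this, Complex.ofReal_im]
  -- The convolution lies between φ/2 and (3/2) φ(· + k) + D/2. The factor 2/3 brings the upper
  -- coefficient to exactly one, so that the moments are compared with T^x for the same x; the lower
  -- coefficient becomes 1/3.
  refine ⟨fun ζ => ((2 / 3 : ℝ) : ℂ) * q₀ ζ, k, D / 3, hqd.const_mul _, fun ζ hζ => ?_,
    fun s => ⟨?_, ?_⟩⟩
  · rw [Complex.re_ofReal_mul]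
    linarith [hlower ζ hζ]
  · rw [Complex.im_ofReal_mul, him, mul_zero]
  · rw [Complex.re_ofReal_mul]
    linarith [hupper s]

end HolomorphicWeight

/-! ### Asymptotic expansions and boundary values -/

theorem iterate_surfDeriv_congr {γ : ℝ} {F G : ℂ → ℂ} (h : EqOn F G (logSector γ)) (p : ℕ) :
    EqOn (surfDeriv^[p] F) (surfDeriv^[p] G) (logSector γ) := by
  induction p with
  | zero => exact h
  | succ p ih =>
    intro ζ hζ
    rw [Function.iterate_succ_apply', Function.iterate_succ_apply', surfDeriv, surfDeriv,
      (ih.eventuallyEq_of_mem ((isOpen_logSector γ).mem_nhds hζ)).deriv_eq]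

theorem iterate_surfDeriv_polynomial (P : Polynomial ℂ) (p : ℕ) :
    surfDeriv^[p] (fun ζ => P.eval (Complex.exp ζ)) =
      fun ζ => (Polynomial.derivative^[p] P).eval (Complex.exp ζ) := by
  induction p with
  | zero => rfl
  | succ p ih =>
    rw [Function.iterate_succ_apply', ih]
    funext ζ
    rw [surfDeriv_comp_exp (fun z => (Polynomial.derivative^[p] P).eval z) ζ
      (Polynomial.differentiableAt _), Polynomial.deriv, Function.iterate_succ_apply']

theorem norm_exp_tendsto_nhdsVertex (γ : ℝ) :
    Tendsto (fun ζ : ℂ => Real.exp ζ.re) (nhdsVertex γ) (𝓝 0) := by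
  have : Tendsto (fun ζ : ℂ => ‖Complex.exp ζ‖) (nhdsVertex γ) (𝓝 0) :=
    tendsto_comap.mono_left inf_le_left
  simpa only [Complex.norm_exp] using this

theorem eventually_mem_logSector (γ : ℝ) : ∀ᶠ ζ in nhdsVertex γ, ζ ∈ logSector γ :=
  mem_inf_of_right (mem_principal_self _)

/-- The Taylor polynomial with coefficients `a_n / n!`, `n < N`. -/
noncomputable def taylorSum (a : ℕ → ℂ) (N : ℕ) : Polynomial ℂ :=
  ∑ n ∈ Finset.range N, Polynomial.C (a n / n.factorial) * Polynomial.X ^ n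

theorem eval_taylorSum (a : ℕ → ℂ) (N : ℕ) (ζ : ℂ) :
    (taylorSum a N).eval (Complex.exp ζ) =
      ∑ n ∈ Finset.range N, a n / n.factorial * Complex.exp (n * ζ) := by
  simp [taylorSum, Polynomial.eval_finsetSum, Complex.exp_nat_mul]

theorem iterate_derivative_taylorSum_self (a : ℕ → ℂ) (N : ℕ) :
    Polynomial.derivative^[N] (taylorSum a N) = 0 := by
  rw [taylorSum, Polynomial.iterate_derivative_sum]
  refine Finset.sum_eq_zero fun n hn => Polynomial.iterate_derivative_eq_zero ?_
  exact (Polynomial.natDegree_C_mul_X_pow_le _ _).trans_lt (Finset.mem_range.1 hn)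

theorem iterate_derivative_taylorSum_succ (a : ℕ → ℂ) (N : ℕ) :
    Polynomial.derivative^[N] (taylorSum a (N + 1)) = Polynomial.C (a N) := by
  have h : taylorSum a (N + 1) =
      taylorSum a N + Polynomial.C (a N / N.factorial) * Polynomial.X ^ N := by
    rw [taylorSum, Finset.sum_range_succ, ← taylorSum]
  rw [h, iterate_map_add, iterate_derivative_taylorSum_self, zero_add,
    Polynomial.iterate_derivative_C_mul, Polynomial.iterate_derivative_X_pow_eq_smul,
    Nat.descFactorial_self, Nat.sub_self, pow_zero]
  have : (N.factorial : ℂ) ≠ 0 := by exact_mod_cast N.factorial_ne_zero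
  rw [Polynomial.smul_eq_C_mul, mul_one, ← Polynomial.C_mul,
    div_mul_cancel₀ _ this]

section Asymptotic

variable {γ δ ρ : ℝ} {F : ℂ → ℂ} {a : ℕ → ℂ} {A : ℕ → ℝ}

theorem iterate_surfDeriv_sub_taylorSum (hF : DifferentiableOn ℂ F (logSector γ)) (N p : ℕ) {ζ : ℂ}
    (hζ : ζ ∈ logSector γ) :
    surfDeriv^[p] (fun ζ => F ζ - (taylorSum a N).eval (Complex.exp ζ)) ζ =
      surfDeriv^[p] F ζ - (Polynomial.derivative^[p] (taylorSum a N)).eval (Complex.exp ζ) := by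
  have hP : DifferentiableOn ℂ (fun ζ => (-taylorSum a N).eval (Complex.exp ζ)) (logSector γ) :=
    ((-taylorSum a N).differentiable.comp Complex.differentiable_exp).differentiableOn
  have h := iterate_surfDeriv_add hF hP p hζ
  rw [Pi.add_apply, iterate_surfDeriv_polynomial] at h
  simp only [Polynomial.iterate_derivative_neg, Polynomial.eval_neg, ← sub_eq_add_neg] at h
  rw [← h]
  congr 2

/-- An asymptotic expansion at the vertex with remainders `A_N |z|^N` bounds all the derivatives
and identifies their boundary values. -/
theorem asymptotic_expansion (hγδ : γ < δ) (hF : DifferentiableOn ℂ F (logSector δ))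
    (hA : ∀ N, 0 ≤ A N)
    (hasymp : ∀ N, ∀ ζ ∈ logSector δ,
      ‖F ζ - ∑ n ∈ Finset.range N, a n / n.factorial * Complex.exp (n * ζ)‖ ≤
        A N * Real.exp (N * ζ.re))
    (hρ : ∀ (F : ℂ → ℂ) (A : ℝ) (N : ℕ), DifferentiableOn ℂ F (logSector δ) → 0 ≤ A →
      (∀ ζ ∈ logSector δ, ‖F ζ‖ ≤ A * Real.exp (N * ζ.re)) → ∀ (p : ℕ), ∀ ζ ∈ logSector γ,
      ‖surfDeriv^[p] F ζ‖ ≤ p.factorial * (A * 2 ^ N) * ρ ^ p * Real.exp ((N - p) * ζ.re)) :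
    (∀ p, ∀ ζ ∈ logSector γ, ‖surfDeriv^[p] F ζ‖ ≤ p.factorial * (A p * 2 ^ p) * ρ ^ p) ∧
      HasBorelImage γ F a := by
  have hsub : logSector γ ⊆ logSector δ := fun ζ hζ => by
    have h : |ζ.im| < γ * Real.pi / 2 := hζ
    exact h.trans (by have := mul_lt_mul_of_pos_right hγδ Real.pi_pos; linarith)
  have hP : ∀ N, DifferentiableOn ℂ (fun ζ => (taylorSum a N).eval (Complex.exp ζ))
      (logSector δ) := fun N =>
    ((taylorSum a N).differentiable.comp Complex.differentiable_exp).differentiableOn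
  have key : ∀ N p : ℕ, ∀ ζ ∈ logSector γ,
      ‖surfDeriv^[p] F ζ - (Polynomial.derivative^[p] (taylorSum a N)).eval (Complex.exp ζ)‖ ≤
        p.factorial * (A N * 2 ^ N) * ρ ^ p * Real.exp ((N - p) * ζ.re) := by
    intro N p ζ hζ
    rw [← iterate_surfDeriv_sub_taylorSum hF N p (hsub hζ)]
    refine hρ _ (A N) N (hF.sub (hP N)) (hA N) (fun w hw => ?_) p ζ hζ
    rw [Pi.sub_apply, eval_taylorSum]
    exact hasymp N w hw
  refine ⟨fun p ζ hζ => ?_, fun p => ?_⟩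
  -- Order N = p: the Taylor polynomial of degree less than p disappears under p derivatives, and
  -- the power of |z| has exponent zero.
  · have := key p p ζ hζ
    rwa [iterate_derivative_taylorSum_self, Polynomial.eval_zero, sub_zero, sub_self, zero_mul,
      Real.exp_zero, mul_one] at this
  · rw [tendsto_iff_norm_sub_tendsto_zero]
    -- Order N = p + 1: the p-th derivative of the polynomial is the constant `a p`, and a factor
    -- |z| remains.
    have hlim := (norm_exp_tendsto_nhdsVertex γ).const_mul
      (p.factorial * (A (p + 1) * 2 ^ (p + 1)) * ρ ^ p)
    rw [mul_zero] at hlim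
    refine squeeze_zero' (Eventually.of_forall fun _ => norm_nonneg _) ?_ hlim
    filter_upwards [eventually_mem_logSector γ] with ζ hζ
    have := key (p + 1) p ζ hζ
    rw [iterate_derivative_taylorSum_succ, Polynomial.eval_C] at this
    simpa using this

end Asymptotic

/-- Functions with bounded derivatives have boundary values of all derivatives at the vertex. -/
theorem exists_hasBorelImage {M : ℕ → ℝ} {h γ : ℝ} (hγ : 0 < γ) {F : ℂ → ℂ}
    (hF : F ∈ ultraholoSubmodule M h γ) : ∃ a ∈ seqSubmodule M h, HasBorelImage γ F a := by
  obtain ⟨hd, -, C, hC0, hC⟩ := hF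
  have hC' : ∀ p, ∀ ζ ∈ logSector γ, ‖surfDeriv^[p] F ζ‖ ≤ C * (h ^ p * M p) :=
    fun p ζ hζ => hC (p, ⟨ζ, hζ⟩)
  have hdiff := differentiableOn_iterate_surfDeriv hd
  have hreal : ∀ r : ℝ, (r : ℂ) ∈ logSector γ := fun r => by
    simp only [logSector, mem_ofPred_eq, Complex.ofReal_im, abs_zero]; positivity
  have hderiv : ∀ p, ∀ ζ ∈ logSector γ, ‖deriv (surfDeriv^[p] F) ζ‖ ≤
      C * (h ^ (p + 1) * M (p + 1)) * Real.exp ζ.re := by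
    intro p ζ hζ
    have h1 := hC' (p + 1) ζ hζ
    rw [Function.iterate_succ_apply', surfDeriv, norm_mul, Complex.norm_exp, Complex.neg_re,
      Real.exp_neg, inv_mul_le_iff₀ (Real.exp_pos _)] at h1
    linarith
  have hlim : ∀ p, ∃ l, Tendsto (surfDeriv^[p] F) (nhdsVertex γ) (𝓝 l) := by
    intro p
    set B := C * (h ^ (p + 1) * M (p + 1))
    have hat : ∀ ζ ∈ logSector γ, DifferentiableAt ℂ (surfDeriv^[p] F) ζ := fun ζ hζ =>
      (hdiff p).differentiableAt ((isOpen_logSector γ).mem_nhds hζ)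
    have hd1 : ∀ t : ℝ, HasDerivAt (fun t : ℝ => surfDeriv^[p] F t)
        (deriv (surfDeriv^[p] F) t) t := fun t => (hat t (hreal t)).hasDerivAt.comp_ofReal
    -- The chain rule supplies a factor e^t, integrable at -∞, so the derivative has a limit along
    -- the real ray.
    have hint : MeasureTheory.IntegrableOn (fun t : ℝ => deriv (surfDeriv^[p] F) t) (Iic 0) := by
      refine ((integrableOn_exp_Iic 0).const_mul B).mono' ?_
        (Eventually.of_forall fun t => hderiv p t (hreal t))
      exact (((hdiff p).deriv (isOpen_logSector γ)).continuousOn.comp_continuous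
        Complex.continuous_ofReal hreal).aestronglyMeasurable
    obtain ⟨l, hl⟩ : ∃ l, Tendsto (fun t : ℝ => surfDeriv^[p] F t) atBot (𝓝 l) :=
      ⟨_, MeasureTheory.tendsto_limUnder_of_hasDerivAt_of_integrableOn_Iic
        (fun t _ => hd1 t) hint⟩
    refine ⟨l, ?_⟩
    have hre : Tendsto (fun ζ : ℂ => ζ.re) (nhdsVertex γ) atBot :=
      Real.tendsto_exp_comp_nhds_zero.1 (norm_exp_tendsto_nhdsVertex γ)
    have h1 := hl.comp hre
    -- Across the strip, the mean value inequality on a vertical segment bounds the variation by B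
    -- e^{Re ζ} γπ/2, so the limit does not depend on the direction.
    have h2 : Tendsto (fun ζ : ℂ => surfDeriv^[p] F ζ - surfDeriv^[p] F ζ.re) (nhdsVertex γ)
        (𝓝 0) := by
      have hz := (norm_exp_tendsto_nhdsVertex γ).const_mul (B * (γ * Real.pi / 2))
      rw [mul_zero] at hz
      refine squeeze_zero_norm' ?_ hz
      filter_upwards [eventually_mem_logSector γ] with ζ hζ
      have hconv : Convex ℝ ({w : ℂ | w.re = ζ.re} ∩ logSector γ) :=
        (convex_hyperplane Complex.reLm.isLinear ζ.re).inter (convex_logSector γ)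
      have h3 := hconv.norm_image_sub_le_of_norm_deriv_le (f := surfDeriv^[p] F)
        (C := B * Real.exp ζ.re) (fun w hw => hat w hw.2)
        (fun w hw => by
          have h4 := hderiv p w hw.2
          have h5 : w.re = ζ.re := hw.1
          rwa [h5] at h4)
        (x := (ζ.re : ℂ)) (y := ζ) ⟨Complex.ofReal_re _, hreal _⟩ ⟨rfl, hζ⟩
      have h6 : ‖ζ - ζ.re‖ ≤ γ * Real.pi / 2 := by
        have h7 : ζ - ζ.re = ζ.im * Complex.I := by
          nth_rewrite 1 [← Complex.re_add_im ζ]; ring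
        rw [h7, norm_mul, Complex.norm_I, mul_one, Complex.norm_real]
        exact le_of_lt hζ
      have h8 : 0 ≤ B * Real.exp ζ.re := (norm_nonneg _).trans (hderiv p ζ hζ)
      nlinarith [mul_le_mul_of_nonneg_left h6 h8]
    simpa using h2.add h1
  choose a ha using hlim
  have := nhdsVertex_neBot hγ
  refine ⟨a, ⟨C, hC0, fun p => ?_⟩, ha⟩
  refine le_of_tendsto (ha p).norm ?_
  filter_upwards [eventually_mem_logSector γ] with ζ hζ using hC' p ζ hζ

/-! ### The truncated Laplace transform -/

/-- The sum of the power series `∑ α_n u^n` at `u = e^s` for `2 b u ≤ 1`, and zero otherwise. -/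
noncomputable def truncatedSeries (α : ℕ → ℂ) (b s : ℝ) : ℂ :=
  {s : ℝ | 2 * b * Real.exp s ≤ 1}.indicator
    (fun s => ∑' n : ℕ, α n * ((Real.exp s ^ n : ℝ) : ℂ)) s

section TruncatedSeries

variable {α α' : ℕ → ℂ} {B B' b : ℝ}

theorem norm_term_le (hα : ∀ n, ‖α n‖ ≤ B * b ^ n) (s : ℝ) (n : ℕ) :
    ‖α n * ((Real.exp s ^ n : ℝ) : ℂ)‖ ≤ B * (b * Real.exp s) ^ n := by
  rw [norm_mul, Complex.norm_real, Real.norm_of_nonneg (by positivity), mul_pow, ← mul_assoc]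
  exact mul_le_mul_of_nonneg_right (hα n) (by positivity)

theorem summable_term (hb : 0 < b) (hα : ∀ n, ‖α n‖ ≤ B * b ^ n) {s : ℝ}
    (hs : 2 * b * Real.exp s ≤ 1) : Summable fun n : ℕ => α n * ((Real.exp s ^ n : ℝ) : ℂ) :=
  Summable.of_norm_bounded
    ((summable_geometric_of_lt_one (by positivity) (by linarith)).mul_left B)
    (norm_term_le hα s)

/-- Where the series is kept, its tail is geometric with ratio at most 1/2. Where it is cut off, 2bu
≥ 1, so (bu)^n ≤ 2^{-n} (2bu)^N for n < N and the partial sum itself obeys the bound. Truncation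
thus costs nothing at any order. -/
theorem norm_truncatedSeries_sub_le (hb : 0 < b) (hB : 0 ≤ B) (hα : ∀ n, ‖α n‖ ≤ B * b ^ n)
    (N : ℕ) (s : ℝ) :
    ‖truncatedSeries α b s - ∑ n ∈ Finset.range N, α n * ((Real.exp s ^ n : ℝ) : ℂ)‖ ≤
      2 * B * (2 * b) ^ N * Real.exp s ^ N := by
  have hy : 0 < b * Real.exp s := by positivity
  rw [truncatedSeries, mul_assoc (2 * B), ← mul_pow, indicator_apply]
  split_ifs with hs
  · have hs' : 2 * b * Real.exp s ≤ 1 := hs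
    rw [norm_sub_rev]
    refine (norm_sub_le_of_geometric_bound_of_hasSum (by linarith) (norm_term_le hα s)
      (summable_term hb hα hs').hasSum N).trans ?_
    rw [div_le_iff₀ (by linarith)]
    have h1 : (b * Real.exp s) ^ N ≤ (2 * b * Real.exp s) ^ N := by
      gcongr; linarith
    have h2 : 0 ≤ B * (2 * b * Real.exp s) ^ N := by positivity
    nlinarith [mul_le_mul_of_nonneg_left h1 hB]
  · have hs' : 1 ≤ 2 * b * Real.exp s := (not_le.1 hs).le
    rw [zero_sub, norm_neg]
    refine (norm_sum_le _ _).trans ?_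
    have h1 : ∀ n ∈ Finset.range N, ‖α n * ((Real.exp s ^ n : ℝ) : ℂ)‖ ≤
        B * (2 * b * Real.exp s) ^ N * (1 / 2) ^ n := by
      intro n hn
      have h2 : (b * Real.exp s) ^ n = (2 * b * Real.exp s) ^ n * (1 / 2) ^ n := by
        rw [← mul_pow]; congr 1; ring
      refine (norm_term_le hα s n).trans ?_
      rw [h2, ← mul_assoc]
      have h3 := pow_le_pow_right₀ hs' (Finset.mem_range.1 hn).le
      gcongr
    refine (Finset.sum_le_sum h1).trans ?_
    rw [← Finset.mul_sum]
    have h4 := sum_geometric_two_le N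
    have h5 : 0 ≤ B * (2 * b * Real.exp s) ^ N := by positivity
    nlinarith [mul_le_mul_of_nonneg_left h4 h5]

theorem norm_truncatedSeries_le (hb : 0 < b) (hB : 0 ≤ B) (hα : ∀ n, ‖α n‖ ≤ B * b ^ n) (s : ℝ) :
    ‖truncatedSeries α b s‖ ≤ 2 * B := by
  simpa using norm_truncatedSeries_sub_le hb hB hα 0 s

theorem measurable_truncatedSeries (hb : 0 < b) (hα : ∀ n, ‖α n‖ ≤ B * b ^ n) :
    Measurable (truncatedSeries α b) := by
  have hS : MeasurableSet {s : ℝ | 2 * b * Real.exp s ≤ 1} :=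
    measurableSet_le (by fun_prop) measurable_const
  refine measurable_of_tendsto_metrizable (f := fun N s => {s : ℝ | 2 * b * Real.exp s ≤ 1}.indicator
    (fun s => ∑ n ∈ Finset.range N, α n * ((Real.exp s ^ n : ℝ) : ℂ)) s)
    (fun N => Measurable.indicator (by fun_prop) hS) (tendsto_pi_nhds.2 fun s => ?_)
  simp only [truncatedSeries, indicator_apply]
  split_ifs with hs
  · exact (summable_term hb hα hs).hasSum.tendsto_sum_nat
  · exact tendsto_const_nhds

/-- The cutoff depends on `b` and not on the coefficients, which keeps the extension linear. -/
theorem truncatedSeries_add (hb : 0 < b) (hα : ∀ n, ‖α n‖ ≤ B * b ^ n)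
    (hα' : ∀ n, ‖α' n‖ ≤ B' * b ^ n) (s : ℝ) :
    truncatedSeries (fun n => α n + α' n) b s =
      truncatedSeries α b s + truncatedSeries α' b s := by
  simp only [truncatedSeries, indicator_apply]
  split_ifs with hs
  · rw [← (summable_term hb hα hs).tsum_add (summable_term hb hα' hs)]
    simp only [add_mul]
  · simp

theorem truncatedSeries_smul (c : ℂ) (s : ℝ) :
    truncatedSeries (fun n => c * α n) b s = c * truncatedSeries α b s := by
  simp only [truncatedSeries, indicator_apply]
  split_ifs with hs
  · rw [← tsum_mul_left]
    simp only [mul_assoc]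
  · simp

end TruncatedSeries

/-- The Laplace kernel `u z⁻¹ exp(-Q(u/z)/x)`, as a function of `log z - log u`. -/
noncomputable def laplaceKernel (q : ℂ → ℂ) (x : ℝ) (w : ℂ) : ℂ :=
  Complex.exp (-w - q (-w) / x)

/-- The moments of the Laplace kernel. -/
noncomputable def laplaceMoment (q : ℂ → ℂ) (x : ℝ) (n : ℕ) : ℂ :=
  ∫ s : ℝ, ((Real.exp s ^ n : ℝ) : ℂ) * laplaceKernel q x (0 - s)

/-- The constant in the estimates for the Laplace transform. -/
noncomputable def laplaceBound (ω : ℝ → ℝ) (x : ℝ) (N : ℕ) : ℝ :=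
  ∫ s : ℝ, Real.exp ((N + 1) * s - 1 / (3 * x) * logWeight ω s)

/-! ### Estimates and moments of the Laplace transform on a sector -/

section Laplace

variable {ω : ℝ → ℝ} {δ x B k C : ℝ} {q : ℂ → ℂ} {c : ℝ → ℂ}

theorem neg_mem_logSector {ζ : ℂ} (hζ : ζ ∈ logSector δ) : -ζ ∈ logSector δ := by
  simpa [logSector] using hζ

theorem differentiableOn_laplaceKernel (hq : DifferentiableOn ℂ q (logSector δ)) :
    DifferentiableOn ℂ (laplaceKernel q x) (logSector δ) := by
  have h1 : DifferentiableOn ℂ (fun w => q (-w)) (logSector δ) :=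
    hq.comp differentiableOn_id.neg fun _ hw => neg_mem_logSector hw
  exact (differentiableOn_id.neg.sub (h1.div_const _)).cexp

theorem norm_laplaceKernel_le (hx : 0 < x)
    (hlow : ∀ ζ ∈ logSector δ, logWeight ω ζ.re ≤ 3 * (q ζ).re) {ζ : ℂ}
    (hζ : ζ ∈ logSector δ) (s : ℝ) :
    ‖laplaceKernel q x (ζ - s)‖ ≤
      Real.exp (s - ζ.re - 1 / (3 * x) * logWeight ω (s - ζ.re)) := by
  have h1 := hlow _ (neg_mem_logSector (sub_ofReal_mem_logSector hζ s))
  have h2 : (-(ζ - s)).re = s - ζ.re := by simp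
  rw [laplaceKernel, Complex.norm_exp, Real.exp_le_exp, Complex.sub_re, Complex.div_ofReal_re, h2]
  rw [h2] at h1
  have h3 : 1 / (3 * x) * logWeight ω (s - ζ.re) ≤ (q (-(ζ - s))).re / x := by
    rw [one_div_mul_eq_div, div_le_div_iff₀ (by positivity) hx]
    nlinarith
  linarith

theorem norm_mul_laplaceKernel_le (hx : 0 < x)
    (hlow : ∀ ζ ∈ logSector δ, logWeight ω ζ.re ≤ 3 * (q ζ).re) {N : ℕ}
    (hc : ∀ s, ‖c s‖ ≤ B * Real.exp s ^ N) {ζ : ℂ} (hζ : ζ ∈ logSector δ) (s : ℝ) :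
    ‖c s * laplaceKernel q x (ζ - s)‖ ≤ B * Real.exp (N * ζ.re) *
      Real.exp ((N + 1) * (s - ζ.re) - 1 / (3 * x) * logWeight ω (s - ζ.re)) := by
  rw [norm_mul]
  refine (mul_le_mul (hc s) (norm_laplaceKernel_le hx hlow hζ s) (norm_nonneg _)
    ((norm_nonneg _).trans (hc s))).trans (le_of_eq ?_)
  rw [← Real.exp_nat_mul, mul_assoc, mul_assoc, ← Real.exp_add, ← Real.exp_add]
  ring_nf

theorem integrable_laplaceBound (hω : IsNormalizedWeight ω) (h3 : Omega3 ω) (hx : 0 < x) (N : ℕ) :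
    MeasureTheory.Integrable fun s : ℝ =>
      Real.exp ((N + 1) * s - 1 / (3 * x) * logWeight ω s) :=
  integrable_exp_sub_logWeight hω h3 (by positivity) (by positivity)

theorem aestronglyMeasurable_laplaceKernel (hq : DifferentiableOn ℂ q (logSector δ)) {ζ : ℂ}
    (hζ : ζ ∈ logSector δ) :
    MeasureTheory.AEStronglyMeasurable fun s : ℝ => laplaceKernel q x (ζ - s) :=
  ((differentiableOn_laplaceKernel hq).continuousOn.comp_continuous (by fun_prop)
    (sub_ofReal_mem_logSector hζ)).aestronglyMeasurable

theorem integrable_mul_laplaceKernel (hω : IsNormalizedWeight ω) (h3 : Omega3 ω) (hx : 0 < x)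
    (hq : DifferentiableOn ℂ q (logSector δ))
    (hlow : ∀ ζ ∈ logSector δ, logWeight ω ζ.re ≤ 3 * (q ζ).re) {N : ℕ}
    (hm : MeasureTheory.AEStronglyMeasurable c) (hc : ∀ s, ‖c s‖ ≤ B * Real.exp s ^ N) {ζ : ℂ}
    (hζ : ζ ∈ logSector δ) :
    MeasureTheory.Integrable fun s : ℝ => c s * laplaceKernel q x (ζ - s) :=
  (((integrable_laplaceBound hω h3 hx N).comp_sub_right ζ.re).const_mul
    (B * Real.exp (N * ζ.re))).mono' (hm.mul (aestronglyMeasurable_laplaceKernel hq hζ))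
    (Eventually.of_forall fun s => norm_mul_laplaceKernel_le hx hlow hc hζ s)

theorem norm_integral_mul_laplaceKernel_le (hω : IsNormalizedWeight ω) (h3 : Omega3 ω)
    (hx : 0 < x) (hlow : ∀ ζ ∈ logSector δ, logWeight ω ζ.re ≤ 3 * (q ζ).re) {N : ℕ}
    (hc : ∀ s, ‖c s‖ ≤ B * Real.exp s ^ N) {ζ : ℂ} (hζ : ζ ∈ logSector δ) :
    ‖∫ s : ℝ, c s * laplaceKernel q x (ζ - s)‖ ≤
      B * laplaceBound ω x N * Real.exp (N * ζ.re) := by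
  refine (MeasureTheory.norm_integral_le_of_norm_le
    (((integrable_laplaceBound hω h3 hx N).comp_sub_right ζ.re).const_mul
      (B * Real.exp (N * ζ.re)))
    (Eventually.of_forall fun s => norm_mul_laplaceKernel_le hx hlow hc hζ s)).trans (le_of_eq ?_)
  rw [MeasureTheory.integral_const_mul, MeasureTheory.integral_sub_right_eq_self
    (fun s : ℝ => Real.exp ((N + 1) * s - 1 / (3 * x) * logWeight ω s)) ζ.re, laplaceBound]
  ring

theorem differentiableOn_integral_mul_laplaceKernel (hω : IsNormalizedWeight ω) (h3 : Omega3 ω)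
    (hx : 0 < x) (hq : DifferentiableOn ℂ q (logSector δ))
    (hlow : ∀ ζ ∈ logSector δ, logWeight ω ζ.re ≤ 3 * (q ζ).re) {N : ℕ} (hB : 0 ≤ B)
    (hm : MeasureTheory.AEStronglyMeasurable c) (hc : ∀ s, ‖c s‖ ≤ B * Real.exp s ^ N) :
    DifferentiableOn ℂ (fun ζ => ∫ s : ℝ, c s * laplaceKernel q x (ζ - s)) (logSector δ) := by
  refine differentiableOn_integral_mul_sub (differentiableOn_laplaceKernel hq) hm fun ζ₀ _ =>
    -- On the unit ball Re ζ < Re ζ₀ + 1, so by monotonicity the weight at s - (Re ζ₀ + 1) serves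
    -- for all ζ; the 2 absorbs the variation of e^{-Re ζ}.
    ⟨1, one_pos, _, ((integrable_laplaceBound hω h3 hx N).comp_sub_right (ζ₀.re + 1)).const_mul
      (B * Real.exp (N * (ζ₀.re + 1) + 2)), fun ζ hζ hζδ s => ?_⟩
  rw [norm_mul]
  refine (mul_le_mul (hc s) (norm_laplaceKernel_le hx hlow hζδ s) (norm_nonneg _)
    ((norm_nonneg _).trans (hc s))).trans ?_
  rw [← Real.exp_nat_mul, mul_assoc, mul_assoc, ← Real.exp_add, ← Real.exp_add]
  refine mul_le_mul_of_nonneg_left (Real.exp_le_exp.2 ?_) hB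
  have h1 : |(ζ - ζ₀).re| ≤ ‖ζ - ζ₀‖ := Complex.abs_re_le_norm _
  rw [Metric.mem_ball, dist_eq_norm] at hζ
  rw [Complex.sub_re] at h1
  obtain ⟨h4, h5⟩ := abs_lt.1 (h1.trans_lt hζ)
  have h6 : 1 / (3 * x) * logWeight ω (s - (ζ₀.re + 1)) ≤
      1 / (3 * x) * logWeight ω (s - ζ.re) :=
    mul_le_mul_of_nonneg_left (logWeight_mono hω (by linarith)) (by positivity)
  linarith

theorem norm_ofReal_exp_pow_le (n : ℕ) (s : ℝ) :
    ‖((Real.exp s ^ n : ℝ) : ℂ)‖ ≤ 1 * Real.exp s ^ n := by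
  rw [Complex.norm_real, Real.norm_of_nonneg (by positivity), one_mul]

theorem aestronglyMeasurable_ofReal_exp_pow (n : ℕ) :
    MeasureTheory.AEStronglyMeasurable fun s : ℝ => ((Real.exp s ^ n : ℝ) : ℂ) :=
  (Complex.continuous_ofReal.comp (Real.continuous_exp.pow n)).aestronglyMeasurable

/-- The Laplace transform of a monomial is a monomial on the whole sector. -/
theorem integral_pow_mul_laplaceKernel (hω : IsNormalizedWeight ω) (h3 : Omega3 ω) (hx : 0 < x)
    (hq : DifferentiableOn ℂ q (logSector δ))
    (hlow : ∀ ζ ∈ logSector δ, logWeight ω ζ.re ≤ 3 * (q ζ).re) (n : ℕ) {ζ : ℂ}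
    (hζ : ζ ∈ logSector δ) :
    ∫ s : ℝ, ((Real.exp s ^ n : ℝ) : ℂ) * laplaceKernel q x (ζ - s) =
      Complex.exp (n * ζ) * laplaceMoment q x n := by
  set Φ : ℂ → ℂ := fun ζ => Complex.exp (-(n * ζ)) *
    ∫ s : ℝ, ((Real.exp s ^ n : ℝ) : ℂ) * laplaceKernel q x (ζ - s) with hΦ
  have hd : DifferentiableOn ℂ Φ (logSector δ) :=
    DifferentiableOn.mul (by fun_prop) (differentiableOn_integral_mul_laplaceKernel hω h3 hx hq hlow
      zero_le_one (aestronglyMeasurable_ofReal_exp_pow n) (norm_ofReal_exp_pow_le n))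
  have hΦ' : ∀ ζ, Φ ζ = ∫ s : ℝ, Complex.exp (-(n * (ζ - s))) * laplaceKernel q x (ζ - s) := by
    intro ζ
    simp only [hΦ]
    rw [← MeasureTheory.integral_const_mul]
    congr 1
    funext s
    rw [← mul_assoc]
    congr 1
    rw [Complex.ofReal_pow, Complex.ofReal_exp, ← Complex.exp_nat_mul, ← Complex.exp_add]
    ring_nf
  -- After division by z^n the integrand depends on ζ - s only, so a translation of s shows
  -- invariance under dilations. Holomorphy then forces constancy, with no rotation of the contour.
  have hinv : ∀ (ζ : ℂ) (t : ℝ), Φ (ζ + t) = Φ ζ := by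
    intro ζ t
    rw [hΦ', hΦ', ← MeasureTheory.integral_add_right_eq_self _ t]
    congr 1
    funext s
    have : ζ + t - ((s + t : ℝ) : ℂ) = ζ - s := by push_cast; ring
    rw [this]
  have h := eqOn_of_forall_add_ofReal hd hinv hζ
  have h0 : Φ 0 = laplaceMoment q x n := by simp [hΦ, laplaceMoment]
  rw [h0] at h
  rw [← h]
  simp only [hΦ]
  rw [← mul_assoc, ← Complex.exp_add, add_neg_cancel, Complex.exp_zero, one_mul]

theorem zero_mem_logSector (hδ : 0 < δ) : (0 : ℂ) ∈ logSector δ := by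
  simp only [logSector, mem_ofPred_eq, Complex.zero_im, abs_zero]; positivity

/-- The moments dominate the weight sequence. -/
theorem weightMatrix_le_laplaceMoment (hω : IsNormalizedWeight ω) (h3 : Omega3 ω) (hx : 0 < x)
    (hδ : 0 < δ) (hq : DifferentiableOn ℂ q (logSector δ))
    (hlow : ∀ ζ ∈ logSector δ, logWeight ω ζ.re ≤ 3 * (q ζ).re)
    (hreal : ∀ s : ℝ, (q s).im = 0 ∧ (q s).re ≤ logWeight ω (s + k) + C) (n : ℕ) :
    weightMatrix ω x n ≤
      Real.exp (C / x + k) * (2 * Real.exp k) ^ n * ‖laplaceMoment q x n‖ := by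
  set m : ℝ := ∫ s : ℝ, Real.exp ((n + 1) * s - (q s).re / x) with hm
  -- As q is real on the line, the moment is the integral of a positive function and can be bounded
  -- below on a half-line.
  have hpt : ∀ s : ℝ, ((Real.exp s ^ n : ℝ) : ℂ) * laplaceKernel q x (0 - s) =
      ((Real.exp ((n + 1) * s - (q s).re / x) : ℝ) : ℂ) := by
    intro s
    have h1 : q s = ((q s).re : ℂ) := Complex.ext rfl (by simp [(hreal s).1])
    rw [laplaceKernel, zero_sub, neg_neg, h1, Complex.ofReal_re, ← Complex.ofReal_div,
      ← Complex.ofReal_sub, ← Complex.ofReal_exp, ← Complex.ofReal_mul, ← Real.exp_nat_mul,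
      ← Real.exp_add]
    ring_nf
  have hmom : laplaceMoment q x n = (m : ℂ) := by
    rw [laplaceMoment, hm, ← integral_complex_ofReal]
    simp only [hpt]
  have hint : MeasureTheory.Integrable fun s : ℝ => Real.exp ((n + 1) * s - (q s).re / x) := by
    have := (integrable_mul_laplaceKernel hω h3 hx hq hlow (aestronglyMeasurable_ofReal_exp_pow n)
      (norm_ofReal_exp_pow_le n) (zero_mem_logSector hδ)).norm
    simpa only [hpt, Complex.norm_real, Real.norm_of_nonneg (Real.exp_pos _).le] using this
  have hm0 : 0 ≤ m := MeasureTheory.integral_nonneg fun s => (Real.exp_pos _).le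
  rw [hmom, Complex.norm_real, Real.norm_of_nonneg hm0]
  refine weightMatrix_le_of_forall hω hx n fun t ht => ?_
  have hn : (0 : ℝ) < n + 1 := by positivity
  -- Only s ≤ t - k is kept, where φ(s+k) ≤ φ(t).
  have hlb : Real.exp (-((logWeight ω t + C) / x)) * (Real.exp ((n + 1) * (t - k)) / (n + 1)) ≤
      m := by
    rw [← integral_exp_mul_Iic hn, ← MeasureTheory.integral_const_mul]
    refine (MeasureTheory.setIntegral_mono_on ((integrableOn_exp_mul_Iic hn _).const_mul _)
      hint.integrableOn measurableSet_Iic fun s hs => ?_).trans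
      (MeasureTheory.setIntegral_le_integral hint
        (Eventually.of_forall fun s => (Real.exp_pos _).le))
    rw [← Real.exp_add, Real.exp_le_exp]
    have h1 : logWeight ω (s + k) ≤ logWeight ω t :=
      logWeight_mono hω (by linarith [mem_Iic.1 hs])
    have h2 : (q s).re / x ≤ (logWeight ω t + C) / x :=
      div_le_div_of_nonneg_right ((hreal s).2.trans (by linarith)) hx.le
    linarith
  -- The factor n + 1 from integrating e^{(n+1)s} is absorbed into 2^n.
  have hpow : (n + 1 : ℝ) ≤ 2 ^ n := by exact_mod_cast Nat.lt_two_pow_self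
  have h1 : Real.exp (n * t - logWeight ω t / x) ≤
      Real.exp (C / x + k) * Real.exp k ^ n * (n + 1) *
        (Real.exp (-((logWeight ω t + C) / x)) * (Real.exp ((n + 1) * (t - k)) / (n + 1))) := by
    have h2 : Real.exp (C / x + k) * Real.exp k ^ n * (n + 1) *
        (Real.exp (-((logWeight ω t + C) / x)) * (Real.exp ((n + 1) * (t - k)) / (n + 1))) =
        Real.exp (n * t - logWeight ω t / x + t) := by
      have : Real.exp (n * t - logWeight ω t / x + t) = Real.exp (C / x + k) * Real.exp k ^ n *
          (Real.exp (-((logWeight ω t + C) / x)) * Real.exp ((n + 1) * (t - k))) := by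
        rw [← Real.exp_nat_mul, ← Real.exp_add, ← Real.exp_add, ← Real.exp_add]
        ring_nf
      rw [this]
      field_simp
    -- The factor u of the kernel raises the exponent to n + 1 and leaves a spare e^t, at least one
    -- because t ≥ 0.
    rw [h2, Real.exp_le_exp]
    linarith
  refine h1.trans ?_
  rw [mul_pow]
  calc _ ≤ Real.exp (C / x + k) * Real.exp k ^ n * (n + 1) * m :=
        mul_le_mul_of_nonneg_left hlb (by positivity)
    _ ≤ Real.exp (C / x + k) * Real.exp k ^ n * 2 ^ n * m := by gcongr
    _ = _ := by ring

/-- The moments of the upper bound are dominated by a weight sequence of larger index. -/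
theorem laplaceBound_le (hω : IsNormalizedWeight ω) (h3 : Omega3 ω) (hx : 0 < x) (N : ℕ) :
    laplaceBound ω x N ≤ weightMatrix ω (8 * x) N *
      ∫ s : ℝ, Real.exp (1 * s - 5 / (24 * x) * logWeight ω s) := by
  have hx8 : 0 < 8 * x := by positivity
  rw [← MeasureTheory.integral_const_mul]
  refine MeasureTheory.integral_mono (integrable_laplaceBound hω h3 hx N)
    ((integrable_exp_sub_logWeight hω h3 one_pos (by positivity)).const_mul _) fun s => ?_
  -- The splitting 1/(3x) = 1/(8x) + 5/(24x): the first part is absorbed by T^{8x}, the second makes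
  -- the remaining integral converge.
  have h1 := exp_sub_logWeight_le_weightMatrix hω h3 hx8 N s
  refine le_trans (le_of_eq ?_) (mul_le_mul_of_nonneg_right h1 (Real.exp_pos _).le)
  simp only
  rw [← Real.exp_add]
  congr 1
  field_simp
  ring

end Laplace

/-! ### The extension operator -/

/-- The coefficients `a_n / (n! m_n)` of the formal Borel transform. -/
noncomputable def borelCoeff (q : ℂ → ℂ) (x : ℝ) (a : ℕ → ℂ) (n : ℕ) : ℂ :=
  ((n.factorial : ℂ) * laplaceMoment q x n)⁻¹ * a n

/-- The truncated Laplace transform of the formal Borel transform. -/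
noncomputable def laplaceExtension (q : ℂ → ℂ) (x b : ℝ) (a : ℕ → ℂ) (ζ : ℂ) : ℂ :=
  ∫ s : ℝ, truncatedSeries (borelCoeff q x a) b s * laplaceKernel q x (ζ - s)

theorem logSector_mono {γ δ : ℝ} (h : γ ≤ δ) : logSector γ ⊆ logSector δ := fun ζ hζ => by
  have h1 : |ζ.im| < γ * Real.pi / 2 := hζ
  exact h1.trans_le (by have := mul_le_mul_of_nonneg_right h Real.pi_pos.le; linarith)

section Extension

variable {ω : ℝ → ℝ} {γ δ x h k C R : ℝ} {q : ℂ → ℂ} {a : ℕ → ℂ}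

/-- Division by n! m_n cancels the weight, because the moments dominate T^x. The remaining geometric
ratio 2e^k h does not involve x, which enters the constant only. -/
theorem norm_borelCoeff_le (hω : IsNormalizedWeight ω) (h3 : Omega3 ω) (hx : 0 < x)
    (hδ : 0 < δ) (hq : DifferentiableOn ℂ q (logSector δ))
    (hlow : ∀ ζ ∈ logSector δ, logWeight ω ζ.re ≤ 3 * (q ζ).re)
    (hreal : ∀ s : ℝ, (q s).im = 0 ∧ (q s).re ≤ logWeight ω (s + k) + C) (hh : 0 < h)
    (ha : ∀ n, ‖a n‖ ≤ R * (h ^ n * weightMatrixHat ω x n)) (hR : 0 ≤ R) (n : ℕ) :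
    ‖borelCoeff q x a n‖ ≤ R * Real.exp (C / x + k) * (2 * Real.exp k * h) ^ n := by
  have h1 := weightMatrix_le_laplaceMoment hω h3 hx hδ hq hlow hreal n
  have hm : 0 < ‖laplaceMoment q x n‖ :=
    pos_of_mul_pos_right ((weightMatrix_pos x n).trans_le h1) (by positivity)
  have hf : (0 : ℝ) < n.factorial := by exact_mod_cast n.factorial_pos
  rw [borelCoeff, norm_mul, norm_inv, norm_mul, Complex.norm_natCast,
    inv_mul_le_iff₀ (by positivity)]
  refine (ha n).trans ?_
  rw [weightMatrixHat, mul_pow _ h]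
  calc R * (h ^ n * (n.factorial * weightMatrix ω x n))
      ≤ R * (h ^ n * (n.factorial *
        (Real.exp (C / x + k) * (2 * Real.exp k) ^ n * ‖laplaceMoment q x n‖))) := by gcongr
    _ = _ := by ring

theorem laplaceMoment_ne_zero (hω : IsNormalizedWeight ω) (h3 : Omega3 ω) (hx : 0 < x)
    (hδ : 0 < δ) (hq : DifferentiableOn ℂ q (logSector δ))
    (hlow : ∀ ζ ∈ logSector δ, logWeight ω ζ.re ≤ 3 * (q ζ).re)
    (hreal : ∀ s : ℝ, (q s).im = 0 ∧ (q s).re ≤ logWeight ω (s + k) + C) (n : ℕ) :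
    laplaceMoment q x n ≠ 0 := by
  have h1 := weightMatrix_le_laplaceMoment hω h3 hx hδ hq hlow hreal n
  exact norm_pos_iff.1 (pos_of_mul_pos_right ((weightMatrix_pos x n).trans_le h1) (by positivity))

theorem differentiableOn_laplaceExtension (hω : IsNormalizedWeight ω) (h3 : Omega3 ω) (hx : 0 < x)
    (hδ : 0 < δ) (hq : DifferentiableOn ℂ q (logSector δ))
    (hlow : ∀ ζ ∈ logSector δ, logWeight ω ζ.re ≤ 3 * (q ζ).re)
    (hreal : ∀ s : ℝ, (q s).im = 0 ∧ (q s).re ≤ logWeight ω (s + k) + C) (hh : 0 < h)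
    (ha : ∀ n, ‖a n‖ ≤ R * (h ^ n * weightMatrixHat ω x n)) (hR : 0 ≤ R) :
    DifferentiableOn ℂ (laplaceExtension q x (2 * Real.exp k * h) a) (logSector δ) := by
  have hα := norm_borelCoeff_le hω h3 hx hδ hq hlow hreal hh ha hR
  have hb : 0 < 2 * Real.exp k * h := by positivity
  refine differentiableOn_integral_mul_laplaceKernel hω h3 hx hq hlow (N := 0)
    (B := 2 * (R * Real.exp (C / x + k))) (by positivity)
    (measurable_truncatedSeries hb hα).aestronglyMeasurable fun s => ?_
  simpa using norm_truncatedSeries_le hb (by positivity) hα s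

theorem integrable_laplaceExtension (hω : IsNormalizedWeight ω) (h3 : Omega3 ω) (hx : 0 < x)
    (hδ : 0 < δ) (hq : DifferentiableOn ℂ q (logSector δ))
    (hlow : ∀ ζ ∈ logSector δ, logWeight ω ζ.re ≤ 3 * (q ζ).re)
    (hreal : ∀ s : ℝ, (q s).im = 0 ∧ (q s).re ≤ logWeight ω (s + k) + C) (hh : 0 < h)
    (ha : ∀ n, ‖a n‖ ≤ R * (h ^ n * weightMatrixHat ω x n)) (hR : 0 ≤ R) {ζ : ℂ}
    (hζ : ζ ∈ logSector δ) :
    MeasureTheory.Integrable fun s : ℝ =>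
      truncatedSeries (borelCoeff q x a) (2 * Real.exp k * h) s * laplaceKernel q x (ζ - s) := by
  have hα := norm_borelCoeff_le hω h3 hx hδ hq hlow hreal hh ha hR
  have hb : 0 < 2 * Real.exp k * h := by positivity
  refine integrable_mul_laplaceKernel hω h3 hx hq hlow (N := 0)
    (B := 2 * (R * Real.exp (C / x + k)))
    (measurable_truncatedSeries hb hα).aestronglyMeasurable (fun s => ?_) hζ
  simpa using norm_truncatedSeries_le hb (by positivity) hα s

/-- The Taylor polynomial is the Laplace transform of the partial sum of the Borel series, so the
difference is the transform of a remainder of size u^N. -/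
theorem norm_laplaceExtension_sub_le (hω : IsNormalizedWeight ω) (h3 : Omega3 ω) (hx : 0 < x)
    (hδ : 0 < δ) (hq : DifferentiableOn ℂ q (logSector δ))
    (hlow : ∀ ζ ∈ logSector δ, logWeight ω ζ.re ≤ 3 * (q ζ).re)
    (hreal : ∀ s : ℝ, (q s).im = 0 ∧ (q s).re ≤ logWeight ω (s + k) + C) (hh : 0 < h)
    (ha : ∀ n, ‖a n‖ ≤ R * (h ^ n * weightMatrixHat ω x n)) (hR : 0 ≤ R) (N : ℕ) {ζ : ℂ}
    (hζ : ζ ∈ logSector δ) :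
    ‖laplaceExtension q x (2 * Real.exp k * h) a ζ -
        ∑ n ∈ Finset.range N, a n / n.factorial * Complex.exp (n * ζ)‖ ≤
      2 * (R * Real.exp (C / x + k)) * (2 * (2 * Real.exp k * h)) ^ N * laplaceBound ω x N *
        Real.exp (N * ζ.re) := by
  have hα := norm_borelCoeff_le hω h3 hx hδ hq hlow hreal hh ha hR
  have hb : 0 < 2 * Real.exp k * h := by positivity
  have hint : ∀ n ∈ Finset.range N, MeasureTheory.Integrable fun s : ℝ =>
      borelCoeff q x a n * (((Real.exp s ^ n : ℝ) : ℂ) * laplaceKernel q x (ζ - s)) := fun n _ =>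
    (integrable_mul_laplaceKernel hω h3 hx hq hlow (aestronglyMeasurable_ofReal_exp_pow n)
      (norm_ofReal_exp_pow_le n) hζ).const_mul _
  have hsum : ∑ n ∈ Finset.range N, a n / n.factorial * Complex.exp (n * ζ) =
      ∫ s : ℝ, ∑ n ∈ Finset.range N,
        borelCoeff q x a n * (((Real.exp s ^ n : ℝ) : ℂ) * laplaceKernel q x (ζ - s)) := by
    rw [MeasureTheory.integral_finsetSum _ hint]
    refine Finset.sum_congr rfl fun n _ => ?_
    rw [MeasureTheory.integral_const_mul,
      integral_pow_mul_laplaceKernel hω h3 hx hq hlow n hζ, borelCoeff]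
    have h1 := laplaceMoment_ne_zero hω h3 hx hδ hq hlow hreal n
    have h2 : (n.factorial : ℂ) ≠ 0 := by exact_mod_cast n.factorial_ne_zero
    field_simp
  rw [hsum, laplaceExtension, ← MeasureTheory.integral_sub
    (integrable_laplaceExtension hω h3 hx hδ hq hlow hreal hh ha hR hζ)
    (MeasureTheory.integrable_finsetSum _ hint)]
  have hfactor : ∀ s : ℝ,
      truncatedSeries (borelCoeff q x a) (2 * Real.exp k * h) s * laplaceKernel q x (ζ - s) -
        ∑ n ∈ Finset.range N,
          borelCoeff q x a n * (((Real.exp s ^ n : ℝ) : ℂ) * laplaceKernel q x (ζ - s)) =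
      (truncatedSeries (borelCoeff q x a) (2 * Real.exp k * h) s -
        ∑ n ∈ Finset.range N, borelCoeff q x a n * ((Real.exp s ^ n : ℝ) : ℂ)) *
          laplaceKernel q x (ζ - s) := by
    intro s
    rw [sub_mul, Finset.sum_mul]
    simp only [mul_assoc]
  simp only [hfactor]
  exact norm_integral_mul_laplaceKernel_le hω h3 hx hlow
    (norm_truncatedSeries_sub_le hb (by positivity) hα N) hζ

theorem laplaceBound_nonneg (N : ℕ) : 0 ≤ laplaceBound ω x N :=
  MeasureTheory.integral_nonneg fun _ => (Real.exp_pos _).le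

/-- For every index `x` and radius `h` there is an extension operator. -/
theorem exists_extension_operator (hω : IsNormalizedWeight ω) (h3 : Omega3 ω) (hδ : 0 < δ)
    (hγδ : γ < δ) (hq : DifferentiableOn ℂ q (logSector δ))
    (hlow : ∀ ζ ∈ logSector δ, logWeight ω ζ.re ≤ 3 * (q ζ).re)
    (hreal : ∀ s : ℝ, (q s).im = 0 ∧ (q s).re ≤ logWeight ω (s + k) + C) :
    ∃ k₀ : ℝ, 0 < k₀ ∧ ∀ x : ℝ, 0 < x → ∀ h : ℝ, 0 < h →
      ∃ E : SeqSpace (weightMatrixHat ω x) h →L[ℂ]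
          UltraholoSpace (weightMatrixHat ω (8 * x)) (k₀ * h) γ,
        ∀ a : SeqSpace (weightMatrixHat ω x) h, HasBorelImage γ (E a).toFun a.toSeq := by
  obtain ⟨ρ, hρ0, hρ⟩ := exists_norm_iterate_surfDeriv_le hγδ
  -- With b = 2e^k h, the product k₀h is (2b)·2·ρ: the factor 2b comes from the remainder of the
  -- truncated series, 2 and ρ from the Cauchy estimates.
  refine ⟨8 * Real.exp k * ρ, by positivity, fun x hx h hh => ?_⟩
  set b := 2 * Real.exp k * h with hb
  have hb0 : 0 < b := by positivity
  set J := ∫ s : ℝ, Real.exp (1 * s - 5 / (24 * x) * logWeight ω s) with hJ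
  have hJ0 : 0 ≤ J := MeasureTheory.integral_nonneg fun _ => (Real.exp_pos _).le
  set K := 2 * Real.exp (C / x + k) * J with hK
  have hK0 : 0 ≤ K := by positivity
  have hsub := logSector_mono hγδ.le
  have ha : ∀ a : SeqSpace (weightMatrixHat ω x) h, ∀ n,
      ‖a.toSeq n‖ ≤ ‖a‖ * (h ^ n * weightMatrixHat ω x n) := fun a => (weightedNorm_mem a.2).2
  set G : SeqSpace (weightMatrixHat ω x) h → ℂ → ℂ := fun a =>
    (logSector γ).indicator (laplaceExtension q x b a.toSeq) with hG
  have hGeq : ∀ a, EqOn (G a) (laplaceExtension q x b a.toSeq) (logSector γ) := fun a =>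
    eqOn_indicator
  have hasymp : ∀ a : SeqSpace (weightMatrixHat ω x) h,
      (∀ p, ∀ ζ ∈ logSector γ, ‖surfDeriv^[p] (laplaceExtension q x b a.toSeq) ζ‖ ≤
        p.factorial * (2 * (‖a‖ * Real.exp (C / x + k)) * (2 * b) ^ p * laplaceBound ω x p *
          2 ^ p) * ρ ^ p) ∧ HasBorelImage γ (laplaceExtension q x b a.toSeq) a.toSeq := fun a =>
    asymptotic_expansion (A := fun N => 2 * (‖a‖ * Real.exp (C / x + k)) * (2 * b) ^ N *
        laplaceBound ω x N) hγδ
      (differentiableOn_laplaceExtension hω h3 hx hδ hq hlow hreal hh (ha a) (norm_nonneg a))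
      (fun N => mul_nonneg (by positivity) (laplaceBound_nonneg N))
      (fun N ζ hζ => norm_laplaceExtension_sub_le hω h3 hx hδ hq hlow hreal hh (ha a)
        (norm_nonneg a) N hζ) hρ
  have hbound : ∀ a : SeqSpace (weightMatrixHat ω x) h, K * ‖a‖ ∈ weightBounds
      (fun i : ℕ × logSector γ => (8 * Real.exp k * ρ * h) ^ i.1 * weightMatrixHat ω (8 * x) i.1)
      (derivFamily γ (G a)) := by
    refine fun a => ⟨by positivity, fun ⟨p, ζ, hζ⟩ => ?_⟩
    simp only [derivFamily]
    rw [iterate_surfDeriv_congr (hGeq a) p hζ]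
    refine ((hasymp a).1 p ζ hζ).trans ?_
    have h1 := laplaceBound_le hω h3 hx p
    calc _ = p.factorial * (2 * (‖a‖ * Real.exp (C / x + k)) * (2 * b) ^ p * 2 ^ p) * ρ ^ p *
          laplaceBound ω x p := by ring
      _ ≤ p.factorial * (2 * (‖a‖ * Real.exp (C / x + k)) * (2 * b) ^ p * 2 ^ p) * ρ ^ p *
          (weightMatrix ω (8 * x) p * J) := mul_le_mul_of_nonneg_left h1 (by positivity)
      _ = K * ‖a‖ * (((2 * b) * 2 * ρ) ^ p * (p.factorial * weightMatrix ω (8 * x) p)) := by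
        rw [hK, mul_pow (2 * b * 2), mul_pow (2 * b)]; ring
      _ = _ := by
        rw [weightMatrixHat, hb]; ring
  have hmem : ∀ a, G a ∈ ultraholoSubmodule (weightMatrixHat ω (8 * x))
      (8 * Real.exp k * ρ * h) γ := fun a =>
    ⟨((differentiableOn_laplaceExtension hω h3 hx hδ hq hlow hreal hh (ha a)
      (norm_nonneg a)).mono hsub).congr (hGeq a), fun ζ hζ => indicator_of_notMem hζ _,
      ⟨_, hbound a⟩⟩
  have hadd : ∀ a a', G (a + a') = G a + G a' := by
    intro a a'
    funext ζ
    rw [Pi.add_apply]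
    by_cases hζ : ζ ∈ logSector γ
    · rw [hGeq _ hζ, hGeq _ hζ, hGeq _ hζ, laplaceExtension, laplaceExtension, laplaceExtension,
        ← MeasureTheory.integral_add
          (integrable_laplaceExtension hω h3 hx hδ hq hlow hreal hh (ha a) (norm_nonneg a)
            (hsub hζ))
          (integrable_laplaceExtension hω h3 hx hδ hq hlow hreal hh (ha a') (norm_nonneg a')
            (hsub hζ))]
      congr 1
      funext s
      rw [← add_mul, ← truncatedSeries_add hb0
        (norm_borelCoeff_le hω h3 hx hδ hq hlow hreal hh (ha a) (norm_nonneg a))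
        (norm_borelCoeff_le hω h3 hx hδ hq hlow hreal hh (ha a') (norm_nonneg a'))]
      congr 2
      funext n
      exact mul_add _ _ _
    · simp only [hG, indicator_of_notMem hζ, add_zero]
  have hsmul : ∀ (c : ℂ) a, G (c • a) = c • G a := by
    intro c a
    funext ζ
    rw [Pi.smul_apply, smul_eq_mul]
    by_cases hζ : ζ ∈ logSector γ
    · rw [hGeq _ hζ, hGeq _ hζ, laplaceExtension, laplaceExtension,
        ← MeasureTheory.integral_const_mul]
      congr 1
      funext s
      rw [← mul_assoc, ← truncatedSeries_smul]
      congr 2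
      funext n
      exact mul_left_comm _ _ _
    · simp only [hG, indicator_of_notMem hζ, mul_zero]
  let L : SeqSpace (weightMatrixHat ω x) h →ₗ[ℂ]
      UltraholoSpace (weightMatrixHat ω (8 * x)) (8 * Real.exp k * ρ * h) γ :=
    { toFun := fun a => ⟨G a, hmem a⟩
      map_add' := fun a a' => Subtype.ext (hadd a a')
      map_smul' := fun c a => Subtype.ext (hsmul c a) }
  refine ⟨L.mkContinuous K fun a => csInf_le weightBounds_bddBelow (hbound a), fun a p => ?_⟩
  refine ((hasymp a).2 p).congr' ?_
  filter_upwards [eventually_mem_logSector γ] with ζ hζ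
  exact (iterate_surfDeriv_congr (hGeq a) p hζ).symm

end Extension

/-- The last two conjuncts say that the Borel map `𝓑 : A_{{T̂}}(S_γ) → Λ_{{T̂}}` is well defined and
that it is surjective. -/
theorem theorem6p3 (τ : ℝ → ℝ) (hτ : IsNormalizedWeight τ) (hτ3 : Omega3 τ)
    (hτγ : 0 < growthIndex τ) (γ : ℝ) (hγ : 0 < γ) (hγτ : ENNReal.ofReal γ < growthIndex τ) :
    (∃ k₀ : ℝ, 0 < k₀ ∧ ∀ x : ℝ, 0 < x → ∀ h : ℝ, 0 < h →
      ∃ E : SeqSpace (weightMatrixHat τ x) h →L[ℂ]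
          UltraholoSpace (weightMatrixHat τ (8 * x)) (k₀ * h) γ,
        ∀ a : SeqSpace (weightMatrixHat τ x) h, HasBorelImage γ (E a).toFun a.toSeq) ∧
    (∀ F ∈ roumieuUltraholo (weightMatrixHat τ) γ,
      ∃ a ∈ roumieuSeq (weightMatrixHat τ), HasBorelImage γ F a) ∧
    (∀ a ∈ roumieuSeq (weightMatrixHat τ),
      ∃ F ∈ roumieuUltraholo (weightMatrixHat τ) γ, HasBorelImage γ F a) := by
  have hext : ∃ k₀ : ℝ, 0 < k₀ ∧ ∀ x : ℝ, 0 < x → ∀ h : ℝ, 0 < h →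
      ∃ E : SeqSpace (weightMatrixHat τ x) h →L[ℂ]
          UltraholoSpace (weightMatrixHat τ (8 * x)) (k₀ * h) γ,
        ∀ a : SeqSpace (weightMatrixHat τ x) h, HasBorelImage γ (E a).toFun a.toSeq := by
    obtain ⟨γ₁, hγγ₁, hγ₁, hgrowth⟩ := exists_growthProperty_of_lt_growthIndex hγτ
    obtain ⟨A, β, D, hA, hβ, hβγ, hD, hAβD⟩ := logWeight_add_le hτ hγ₁ hgrowth
    -- The kernel parameter b = 1/γ₁ exceeds the growth rate β, and the midpoint δ leaves room on
    -- both sides: bδ < 1 for the kernel, γ < δ for the Cauchy estimates.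
    have hδ : 0 < (γ + γ₁) / 2 := by linarith
    have hbδ : 1 / γ₁ * ((γ + γ₁) / 2) < 1 := by
      rw [one_div_mul_eq_div, div_lt_one hγ₁]; linarith
    obtain ⟨q, k, C, hq, hlow, hreal⟩ :=
      exists_holomorphic_comparable hτ hδ hβ hβγ hbδ hA hD hAβD
    exact exists_extension_operator hτ hτ3 hδ (by linarith) hq hlow hreal
  refine ⟨hext, ?_, ?_⟩
  · rintro F ⟨x, hx, h, hh, hF⟩
    obtain ⟨a, ha, hFa⟩ := exists_hasBorelImage hγ hF
    exact ⟨a, ⟨x, hx, h, hh, ha⟩, hFa⟩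
  · rintro a ⟨x, hx, h, hh, ha⟩
    obtain ⟨k₀, hk₀, hE⟩ := hext
    obtain ⟨E, hEa⟩ := hE x hx h hh
    let a' : SeqSpace (weightMatrixHat τ x) h := ⟨a, ha⟩
    exact ⟨(E a').toFun, ⟨8 * x, by positivity, k₀ * h, by positivity, (E a').2⟩, hEa a'⟩
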